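/- Let $K$ be an algebraically closed field of characteristic $0$. Let $\pi: X\to\mathbb{P}^4$ be the blow-up of $\mathbb{P}^4$ over $K$ at $14$ points $p_1,\dots,p_{14}$ in general position (that is, the claim holds for all $(p_1,\dots,p_{14})$ in some nonempty Zariski open subset of $(\mathbb{P}^4)^{14}$), with exceptional divisors $E_1,\dots,E_{14}$. Let $H$ be the pull-back of the hyperplane class. For a divisor class $D'=dH-m_1E_1-\dots-m_{14}E_{14}$ with $d,m_i\ge 0$, let $|D'|$ be the linear system of effective divisors on $X$ in this class. It corresponds to the hypersurfaces of degree $d$ in $\mathbb{P}^4$ with multiplicity at least $m_i$ at $p_i$ for every $i$, and $\dim|D'|=h^0(X,D')-1$. The virtual dimension of $D'$ is $v(D')=\binom{d+4}{4}-\sum_{i=1}^{14}\binom{m_i+3}{4}-1$, its expected dimension is $e(D')=\max\{-1,v(D')\}$, and $D'$ is called special if $\dim|D'|>e(D')$. The base locus $\mathrm{Bs}\,|D'|\subseteq X$ is the intersection of all members of $|D'|$. Put $D=2H-E_1-\dots-E_{14}$. Then $4D$ is non-special, $\dim|4D|=4$, and the base locus $\mathrm{Bs}\,|4D|\subseteq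 X$ has dimension at most $0$ (it may be empty), whereas $2D$ is special. -/

import Mathlib

open scoped LinearAlgebra.Projectivization

namespace PointBlowUp

/-- Projective `n`-space over `K`, with homogeneous coordinates indexed by `Fin (n + 1)`. -/
abbrev ProjSpace (K : Type*) [Field K] (n : ℕ) : Type _ := ℙ K (Fin (n + 1) → K)

/-- A property `P` of `r`-tuples of points of `ℙⁿ` holds for `r` points in general position if
it holds on a nonempty Zariski open subset of `(ℙⁿ)ʳ`: there is a nonzero polynomial `Φ` in the
homogeneous coordinates of the points such that `P` holds for every tuple admitting homogeneous
coordinates at which `Φ` does not vanish. -/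
def ForGeneralPoints (K : Type*) [Field K] (n r : ℕ)
    (P : (Fin r → ProjSpace K n) → Prop) : Prop :=
  ∃ Φ : MvPolynomial (Fin r × Fin (n + 1)) K, Φ ≠ 0 ∧
    ∀ (x : Fin r → Fin (n + 1) → K) (hx : ∀ i, x i ≠ 0),
      MvPolynomial.eval (fun ij => x ij.1 ij.2) Φ ≠ 0 →
        P (fun i => Projectivization.mk K (x i) (hx i))

/-- The (closed points of the) blow-up `X` of `ℙⁿ = ℙ(V)`, `V = Kⁿ⁺¹`, at the distinct points
`p₀, …, p_{r-1}`, as the closed subvariety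
`{(x, (ℓᵢ)ᵢ) | the projection of x from pᵢ lies in ℓᵢ}` of `ℙ(V) × ∏ᵢ ℙ(V / pᵢ)`.
For `x ≠ pᵢ` the component `ℓᵢ` is determined by `x`. For `x = pᵢ` it is an arbitrary point of
`ℙ(V / pᵢ)`, that is, a line through `pᵢ`, or a tangent direction at `pᵢ`. -/
structure BlowUp {K : Type*} [Field K] {n r : ℕ} (p : Fin r → ProjSpace K n) where
  /-- the image `π(z)` in `ℙⁿ` -/
  pt : ProjSpace K n
  /-- the line through `pᵢ` -/
  dir : ∀ i, ℙ K ((Fin (n + 1) → K) ⧸ (p i).submodule)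
  incident : ∀ i, pt.submodule.map (p i).submodule.mkQ ≤ (dir i).submodule

section

variable {K : Type*} [Field K] {n r : ℕ} (p : Fin r → ProjSpace K n)

/-- `a ∈ V` and `yᵢ ∈ V` are homogeneous coordinates of the point `z` of `X`: `a` spans the line
`π(z)`, and the class of `yᵢ` in `V / pᵢ` spans the line `ℓᵢ`. -/
def BlowUp.IsCoord {p : Fin r → ProjSpace K n} (z : BlowUp p)
    (a : Fin (n + 1) → K) (y : Fin r → Fin (n + 1) → K) : Prop :=
  (a ≠ 0 ∧ a ∈ z.pt.submodule) ∧
    ∀ i, (p i).submodule.mkQ (y i) ≠ 0 ∧ (p i).submodule.mkQ (y i) ∈ (z.dir i).submodule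

/-- The points of `X` at which the polynomial `f` is nonzero for some choice of homogeneous
coordinates. If `f` is multihomogeneous and depends on `yᵢ` only modulo `pᵢ`, then this is the
usual nonvanishing locus of `f`. For other `f` it is a union of such loci. -/
def BlowUp.nonvanishing (f : MvPolynomial (Fin (n + 1) ⊕ Fin r × Fin (n + 1)) K) :
    Set (BlowUp p) :=
  {z | ∃ a y, z.IsCoord a y ∧ MvPolynomial.eval (Sum.elim a fun ij => y ij.1 ij.2) f ≠ 0}

/-- The Zariski topology of `X` as a subvariety of a product of projective spaces. -/
instance BlowUp.zariskiTopology : TopologicalSpace (BlowUp p) :=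
  TopologicalSpace.generateFrom (Set.range (BlowUp.nonvanishing p))

/-- The divisor class `d H - ∑ᵢ mᵢ Eᵢ` on `X`, where `H` is the pull-back of the hyperplane class
and `Eᵢ` is the exceptional divisor over `pᵢ`. -/
@[ext]
structure DivisorClass (r : ℕ) where
  /-- the coefficient `d` of `H` -/
  deg : ℕ
  /-- the coefficients `mᵢ` of the `-Eᵢ` -/
  mult : Fin r → ℕ

/-- Multiples: `a (d H - ∑ mᵢ Eᵢ) = (a d) H - ∑ (a mᵢ) Eᵢ`. -/
instance : SMul ℕ (DivisorClass r) where
  smul a D := ⟨a * D.deg, fun i => a * D.mult i⟩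

/-- The polynomial `F(a + t v)` in `t`, i.e. the restriction of `F` to the line through the point
`a` in the direction `v`. With `a` representing `pᵢ`, it describes the pull-back of `F` to `X`
along a curve meeting `Eᵢ` transversally at the point given by the class of `v` in `V / pᵢ`;
the variable `t` restricts a local equation of `Eᵢ`. -/
noncomputable def lineRestriction (F : MvPolynomial (Fin (n + 1)) K) (a v : Fin (n + 1) → K) :
    Polynomial K :=
  MvPolynomial.aeval (fun j => Polynomial.C (a j) + Polynomial.X * Polynomial.C (v j)) F

/-- The space `H⁰(X, d H - ∑ᵢ mᵢ Eᵢ)`: the forms `F` of degree `d` (the sections of the pull-back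
of `𝒪(d)`) whose pull-back to `X` vanishes to order at least `mᵢ` along `Eᵢ` for every `i`. In other
words the hypersurface `F = 0` has multiplicity at least `mᵢ` at `pᵢ`. As `F` is homogeneous, the
condition does not depend on the representative of `pᵢ`. -/
def globalSections (D : DivisorClass r) : Submodule K (MvPolynomial (Fin (n + 1)) K) where
  carrier := {F | F.IsHomogeneous D.deg ∧
    ∀ i v, ∀ k < D.mult i, (lineRestriction F (p i).rep v).coeff k = 0}
  add_mem' := by
    rintro F G ⟨hF, hF'⟩ ⟨hG, hG'⟩
    refine ⟨hF.add hG, fun i v k hk => ?_⟩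
    have h1 := hF' i v k hk
    have h2 := hG' i v k hk
    simp only [lineRestriction] at h1 h2 ⊢
    rw [map_add, Polynomial.coeff_add, h1, h2, add_zero]
  zero_mem' := ⟨MvPolynomial.isHomogeneous_zero _ _ _, fun i v k _ => by simp [lineRestriction]⟩
  smul_mem' := by
    rintro c F ⟨hF, hF'⟩
    refine ⟨(MvPolynomial.homogeneousSubmodule (Fin (n + 1)) K D.deg).smul_mem c hF,
      fun i v k hk => ?_⟩
    have h1 := hF' i v k hk
    simp only [lineRestriction] at h1 ⊢
    rw [map_smul, Polynomial.coeff_smul, h1, smul_zero]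

/-- `dim |D| = h⁰(X, D) - 1`, so that `dim |D| = -1` if and only if `|D|` is empty. -/
noncomputable def dimLinearSystem (D : DivisorClass r) : ℤ :=
  (Module.finrank K (globalSections p D) : ℤ) - 1

/-- The support of the effective divisor `π^*{F = 0} - ∑ᵢ mᵢ Eᵢ` of the linear system `|D|` that
belongs to a nonzero `F ∈ H⁰(X, D)`. Outside the exceptional divisors it is given by `F = 0`. At a
point of `Eᵢ` the local equation is `F / tᵐ` with `m = mᵢ` and `t` a local equation of `Eᵢ`, so
that on `Eᵢ = ℙ(V / pᵢ)` the divisor is cut out by the leading coefficient, that of `tᵐ` in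
`F(pᵢ + t v)`. -/
def divisorSupport (D : DivisorClass r) (F : MvPolynomial (Fin (n + 1)) K) : Set (BlowUp p) :=
  {z | ((∀ i, z.pt ≠ p i) → MvPolynomial.eval z.pt.rep F = 0) ∧
    ∀ i, z.pt = p i → ∀ v, (p i).submodule.mkQ v ∈ (z.dir i).submodule →
      (lineRestriction F (p i).rep v).coeff (D.mult i) = 0}

/-- The base locus `Bs |D| ⊆ X`: the intersection of all the members of `|D|`. -/
def baseLocus (D : DivisorClass r) : Set (BlowUp p) :=
  ⋂ F ∈ {F | F ∈ globalSections p D ∧ F ≠ 0}, divisorSupport p D F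

/-- The virtual dimension `binom(d+n, n) - ∑ᵢ binom(n+mᵢ-1, n) - 1`. -/
def virtualDim (n : ℕ) (D : DivisorClass r) : ℤ :=
  ((D.deg + n).choose n : ℤ) - ∑ i, ((n + D.mult i - 1).choose n : ℤ) - 1

/-- The expected dimension. -/
def expectedDim (n : ℕ) (D : DivisorClass r) : ℤ := max (-1) (virtualDim n D)

/-- `D` is special if `dim |D|` exceeds the expected dimension. -/
def IsSpecial (D : DivisorClass r) : Prop := expectedDim n D < dimLinearSystem p D

end

/-- The divisor class `2 H - E₁ - ⋯ - E₁₄`. -/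
def quadricClass : DivisorClass 14 := ⟨2, fun _ => 1⟩

end PointBlowUp

/-!
The conditions that appear in the statement are open in the points. For the independence of the
multiplicity conditions this is the openness of a rank condition. For the finiteness of the base
locus it is the invertibility of a Macaulay matrix: if the products of given forms with monomials,
together with the multiples of one coordinate, span all forms of some degree `N`, then the given
forms have no common zero on the hyperplane where the coordinate vanishes, so that they have
finitely many common zeros (`eq_zero_of_macaulay`, `finite_of_macaulay`). Therefore it suffices to
find one suitable configuration of points, and it may be chosen modulo a prime: all matrices are
defined over the ring `CoordRing` of polynomials with integer coefficients in the coordinates of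
the points, and a matrix that becomes invertible for special points modulo `29` has over this ring
an inverse up to a nonzero factor `Δ` (`exists_left_inverse_of_specialization`). As the
multiplicity conditions are independent, the forms through the special points lift to forms over
this ring (`exists_universal_forms`). The open set is the complement of the zeros of the factors
that occur (`exists_forall_generalPosition`).

The special points modulo `29` form two orbits of a cyclic group of order `7` which acts
diagonally with weights `(0, 1, 2, 5, 6)`. The group splits the conditions on octics into seven
blocks, one for each weight, and independence is checked for each block
(`vecMul_condMatrix_specialPt_injective`). The octics of multiplicity `4` at these points are
spanned by the fourth power of a quadric `Q` and by four octics of the weights `1`, `2`, `5`, `6`.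

* The forms have no common zero on the hyperplane `x₀ = 0`. There `Q` defines `ℙ¹ × ℙ¹`, on which
  the multiples of the octics span all the forms of bidegree `(15, 15)`
  (`macaulay_specialForm_injective`).
* On the exceptional divisor over a point, which is identified with the hyperplane `x₀ = 0`, the
  members of `|4D|` cut out the leading quartics of the octics. Those at the first special point
  have no common zero with `x₄ = 0` (`macaulay_leadingForm_injective`). A permutation of the
  points takes care of the other exceptional divisors.

The ranks are verified by `eliminate`, a Gaussian elimination modulo `29` with rows packed into
natural numbers, which the kernel evaluates.

It follows that for general points `h⁰(4D) = 495 - 490 = 5`, which is the expected value, and that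
the base locus is finite. As the points of the blow-up are closed (`BlowUp.t1Space`), it is
discrete and has dimension at most `0`. Finally `2D` is special for any fourteen points: its
expected dimension is `-1`, but the `15`-dimensional space of quadrics contains a nonzero one
through the points, and the square of this quadric is a section of `2D`.
-/

namespace PointBlowUp

/-! ### Certified Gaussian elimination modulo a prime -/

/-- `f n`, written so that the kernel evaluates `n` to a numeral before it unfolds `f`. -/
def withValue {α : Type*} (n : ℕ) (f : ℕ → α) : α := Nat.rec (f 0) (fun m _ => f (m + 1)) n

theorem withValue_eq {α : Type*} (n : ℕ) (f : ℕ → α) : withValue n f = f n := by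
  cases n <;> rfl

/-- The number whose `n` lowest digits in base `B` are those of `r`, each reduced modulo `p`. -/
def reduceDigits (p B : ℕ) : ℕ → ℕ → ℕ
  | 0, _ => 0
  | n + 1, r => r % B % p + B * reduceDigits p B n (r / B)

/-- Gaussian elimination modulo `p` on rows of length `n`, each row being stored as a single natural
number whose digits in base `B` are the entries, the first column being the lowest digit. Digits are
reduced modulo `p` only in the pivot rows, so `B` has to be large enough to prevent carries.
The value is `true` if every column gets a pivot. -/
def eliminate (p B : ℕ) : ℕ → List ℕ → Bool
  | 0, _ => true
  | n + 1, rows =>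
    match rows.find? (fun r => r % B % p != 0) with
    | none => false
    | some r =>
      withValue (reduceDigits p B (n + 1) r) fun s =>
      withValue ((p - 1) * (s % B) ^ (p - 2) % p) fun t =>
        eliminate p B n ((rows.eraseP fun r => r % B % p != 0).map fun q =>
          (q + q % B * t % p * s) / B)

/-- The number `r` has `n` digits in base `B`, all at most `b` (which may exceed `B`), and the row
formed by these digits annihilates the column vector `v` modulo `p`. -/
def PackedRelation (p B n b r : ℕ) (v : ℕ → ZMod p) : Prop :=
  ∃ L : ℕ → ℕ, r = ∑ i ∈ Finset.range n, L i * B ^ i ∧ (∀ i, L i ≤ b) ∧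
    ∑ i ∈ Finset.range n, (L i : ZMod p) * v i = 0

theorem sum_digits_succ (B n : ℕ) (L : ℕ → ℕ) :
    ∑ i ∈ Finset.range (n + 1), L i * B ^ i =
      L 0 + B * ∑ i ∈ Finset.range n, L (i + 1) * B ^ i := by
  rw [Finset.sum_range_succ', Finset.mul_sum, add_comm]
  simp only [pow_zero, mul_one]
  congr 1
  exact Finset.sum_congr rfl fun i _ => by ring

theorem sum_digits_succ_mod {B n : ℕ} {L : ℕ → ℕ} (h : L 0 < B) :
    (∑ i ∈ Finset.range (n + 1), L i * B ^ i) % B = L 0 := by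
  rw [sum_digits_succ, Nat.add_mul_mod_self_left, Nat.mod_eq_of_lt h]

theorem sum_digits_succ_div {B n : ℕ} {L : ℕ → ℕ} (h : L 0 < B) :
    (∑ i ∈ Finset.range (n + 1), L i * B ^ i) / B = ∑ i ∈ Finset.range n, L (i + 1) * B ^ i := by
  rw [sum_digits_succ, Nat.add_mul_div_left _ _ (by omega), Nat.div_eq_of_lt h, zero_add]

theorem reduceDigits_sum_digits (p : ℕ) {B : ℕ} (n : ℕ) {L : ℕ → ℕ} (h : ∀ i, L i < B) :
    reduceDigits p B n (∑ i ∈ Finset.range n, L i * B ^ i) =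
      ∑ i ∈ Finset.range n, L i % p * B ^ i := by
  induction n generalizing L with
  | zero => simp [reduceDigits]
  | succ n ih =>
    rw [reduceDigits, sum_digits_succ_mod (h 0), sum_digits_succ_div (h 0),
      ih (L := fun i => L (i + 1)) fun i => h (i + 1), sum_digits_succ B n (fun i => L i % p)]

/-- A row with entry `q`, plus `q * t` times the pivot row with entry `s`, has entry `0`. -/
theorem cast_add_mul_pivot_eq_zero {p : ℕ} [Fact p.Prime] (q s : ℕ) (hs : (s : ZMod p) ≠ 0) :
    ((q + q * ((p - 1) * s ^ (p - 2) % p) % p * s : ℕ) : ZMod p) = 0 := by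
  have hp : 2 ≤ p := (Fact.out : p.Prime).two_le
  have h : (s : ZMod p) ^ (p - 2) * s = 1 := by
    rw [← pow_succ, show p - 2 + 1 = p - 1 by omega]
    exact ZMod.pow_card_sub_one_eq_one hs
  push_cast [ZMod.natCast_mod]
  rw [Nat.cast_sub (by omega)]
  simp only [CharP.cast_eq_zero, Nat.cast_one, zero_sub]
  linear_combination (-(q : ZMod p)) * h

theorem eliminate_sound {p : ℕ} [Fact p.Prime] {B : ℕ} (n : ℕ) {b : ℕ} {rows : List ℕ}
    {v : ℕ → ZMod p} (h : eliminate p B n rows = true) (hb : b + n * (p * p) < B)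
    (hrows : ∀ r ∈ rows, PackedRelation p B n b r v) : ∀ i < n, v i = 0 := by
  induction n generalizing b rows v with
  | zero => intro i hi; omega
  | succ n ih =>
    have hp : 0 < p := (Fact.out : p.Prime).pos
    have hpB : p < B := by nlinarith
    have hbB : b < B := by nlinarith
    rw [eliminate] at h
    split at h
    · exact absurd h (by simp)
    rename_i r hr
    simp only [withValue_eq] at h
    obtain ⟨L, rfl, hLb, hL⟩ := hrows r (List.mem_of_find?_eq_some hr)
    have hpiv := List.find?_some hr
    simp only [bne_iff_ne, ne_eq] at hpiv
    rw [sum_digits_succ_mod ((hLb 0).trans_lt hbB)] at hpiv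
    rw [reduceDigits_sum_digits p (n + 1) fun i => (hLb i).trans_lt hbB] at h
    have hmod : ∀ i, L i % p < B := fun i => (Nat.mod_lt _ hp).trans hpB
    have hL0 : ((L 0 % p : ℕ) : ZMod p) ≠ 0 := by
      rw [Ne, ZMod.natCast_eq_zero_iff]
      exact fun hd => hpiv (Nat.eq_zero_of_dvd_of_lt hd (Nat.mod_lt _ hp))
    have hmodL : ∑ i ∈ Finset.range (n + 1), ((L i % p : ℕ) : ZMod p) * v i = 0 := by
      simpa only [ZMod.natCast_mod] using hL
    have htail : ∀ i < n, v (i + 1) = 0 := by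
      refine ih (b := b + p * p) (v := fun i => v (i + 1)) h ?_ ?_
      · calc b + p * p + n * (p * p) = b + (n + 1) * (p * p) := by ring
          _ < B := hb
      · intro q' hq'
        obtain ⟨q, hq, rfl⟩ := List.mem_map.mp hq'
        obtain ⟨M, rfl, hMb, hM⟩ := hrows q (List.mem_of_mem_eraseP hq)
        rw [sum_digits_succ_mod ((hMb 0).trans_lt hbB),
          sum_digits_succ_mod (L := fun i => L i % p) (hmod 0)]
        set c := M 0 * ((p - 1) * (L 0 % p) ^ (p - 2) % p) % p with hc
        have hcp : c < p := Nat.mod_lt _ hp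
        have hbound : ∀ i, M i + c * (L i % p) ≤ b + p * p := fun i =>
          add_le_add (hMb i) (Nat.mul_le_mul hcp.le (Nat.mod_lt _ hp).le)
        have hlt : M 0 + c * (L 0 % p) < B := (hbound 0).trans_lt (by nlinarith)
        have hsum : ∑ i ∈ Finset.range (n + 1), M i * B ^ i +
            c * ∑ i ∈ Finset.range (n + 1), L i % p * B ^ i =
            ∑ i ∈ Finset.range (n + 1), (M i + c * (L i % p)) * B ^ i := by
          rw [Finset.mul_sum, ← Finset.sum_add_distrib]
          exact Finset.sum_congr rfl fun i _ => by ring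
        rw [hsum, sum_digits_succ_div (L := fun i => M i + c * (L i % p)) hlt]
        refine ⟨fun i => M (i + 1) + c * (L (i + 1) % p), rfl, fun i => hbound _, ?_⟩
        have hz : ∑ i ∈ Finset.range (n + 1), ((M i + c * (L i % p) : ℕ) : ZMod p) * v i = 0 := by
          simp only [Nat.cast_add, Nat.cast_mul, add_mul, Finset.sum_add_distrib, mul_assoc,
            ← Finset.mul_sum]
          rw [hM, hmodL, mul_zero, add_zero]
        rw [Finset.sum_range_succ', cast_add_mul_pivot_eq_zero _ _ hL0, zero_mul, add_zero] at hz
        exact hz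
    have hv0 : v 0 = 0 := by
      rw [Finset.sum_range_succ', Finset.sum_eq_zero, zero_add] at hmodL
      · exact (mul_eq_zero.mp hmodL).resolve_left hL0
      · intro i hi
        rw [htail i (Finset.mem_range.mp hi), mul_zero]
    intro i hi
    cases i with
    | zero => exact hv0
    | succ i => exact htail i (by omega)

/-- The row with the given entries, as a single number. -/
def packDense (p B : ℕ) : List ℕ → ℕ
  | [] => 0
  | d :: l => d % p + B * packDense p B l

/-- The row that is the sum of the entries `c` in column `k`, over all the pairs `(k, c)` in the
list, as a single number. -/
def packSparse (B : ℕ) (l : List (ℕ × ℕ)) : ℕ := (l.map fun kc => kc.2 * B ^ kc.1).sum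

theorem packedRelation_packDense {p : ℕ} [Fact p.Prime] (B : ℕ) (l : List ℕ) (v : ℕ → ZMod p)
    (h : ∑ i ∈ Finset.range l.length, (l.getD i 0 : ZMod p) * v i = 0) :
    PackedRelation p B l.length p (packDense p B l) v := by
  refine ⟨fun i => l.getD i 0 % p, ?_, fun i => (Nat.mod_lt _ (Fact.out : p.Prime).pos).le, ?_⟩
  · clear h
    induction l with
    | nil => simp [packDense]
    | cons d l ih =>
      rw [List.length_cons, sum_digits_succ B l.length fun i => (d :: l).getD i 0 % p, packDense,
          ih]
      rfl
  · simpa only [ZMod.natCast_mod] using h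

theorem packedRelation_packSparse {p B n : ℕ} (l : List (ℕ × ℕ)) (v : ℕ → ZMod p)
    (hn : ∀ kc ∈ l, kc.1 < n) (h : (l.map fun kc => (kc.2 : ZMod p) * v kc.1).sum = 0) :
    PackedRelation p B n (l.map Prod.snd).sum (packSparse B l) v := by
  suffices H : ∃ L : ℕ → ℕ, packSparse B l = ∑ i ∈ Finset.range n, L i * B ^ i ∧
      (∀ i, L i ≤ (l.map Prod.snd).sum) ∧ ∑ i ∈ Finset.range n, (L i : ZMod p) * v i =
        (l.map fun kc => (kc.2 : ZMod p) * v kc.1).sum by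
    obtain ⟨L, h1, h2, h3⟩ := H
    exact ⟨L, h1, h2, h3.trans h⟩
  clear h
  induction l with
  | nil => exact ⟨fun _ => 0, by simp [packSparse]⟩
  | cons kc l ih =>
    obtain ⟨L, h1, h2, h3⟩ := ih fun x hx => hn x (List.mem_cons_of_mem _ hx)
    have hk := Finset.mem_range.mpr (hn kc List.mem_cons_self)
    refine ⟨fun i => (if i = kc.1 then kc.2 else 0) + L i, ?_, fun i => ?_, ?_⟩
    · simp only [add_mul, Finset.sum_add_distrib, ← h1, ite_mul, zero_mul, Finset.sum_ite_eq',
        if_pos hk]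
      simp [packSparse]
    · simp only [List.map_cons, List.sum_cons]
      refine add_le_add ?_ (h2 i)
      split <;> simp
    · simp only [Nat.cast_add, add_mul, Finset.sum_add_distrib, h3, List.map_cons, List.sum_cons,
        Nat.cast_ite, Nat.cast_zero, ite_mul, zero_mul, Finset.sum_ite_eq', if_pos hk]

/-! ### Forms, Hasse derivatives and multiplicity conditions -/

/-- The exponents of the monomials of degree `d` in `n` variables. -/
abbrev expo (n d : ℕ) : Finset (Fin n → ℕ) := Finset.Nat.antidiagonalTuple n d

theorem mem_expo {n d : ℕ} {α : Fin n → ℕ} : α ∈ expo n d ↔ ∑ j, α j = d :=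
  Finset.Nat.mem_antidiagonalTuple

theorem add_mem_expo {n d e : ℕ} {α β : Fin n → ℕ} (hα : α ∈ expo n d) (hβ : β ∈ expo n e) :
    α + β ∈ expo n (d + e) := by
  rw [mem_expo] at *
  simp [Finset.sum_add_distrib, hα, hβ]

theorem single_mem_expo {n : ℕ} (j : Fin n) : (Pi.single j 1 : Fin n → ℕ) ∈ expo n 1 := by
  simp [mem_expo]

section

variable {A : Type*} [CommRing A] {n : ℕ}

/-- The monomial `z ^ α`. -/
def mpow (z : Fin n → A) (α : Fin n → ℕ) : A := ∏ j, z j ^ α j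

theorem mpow_add (z : Fin n → A) (α β : Fin n → ℕ) : mpow z (α + β) = mpow z α * mpow z β := by
  simp [mpow, pow_add, Finset.prod_mul_distrib]

theorem mpow_single (z : Fin n → A) (j : Fin n) : mpow z (Pi.single j 1) = z j := by
  rw [mpow, Finset.prod_eq_single j] <;> simp +contextual

/-- The `β`-th Hasse derivative of the monomial with exponent `α` at the point `a`. -/
def jet (a : Fin n → A) (α β : Fin n → ℕ) : A :=
  ∏ j, ((α j).choose (β j) : A) * a j ^ (α j - β j)

/-- The `β`-th Hasse derivative at `a` of the form of degree `d` with coefficients `c`. -/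
def hasse (d : ℕ) (c : (Fin n → ℕ) → A) (a : Fin n → A) (β : Fin n → ℕ) : A :=
  ∑ α ∈ expo n d, c α * jet a α β

theorem map_jet {A' : Type*} [CommRing A'] (f : A →+* A') (a : Fin n → A) (α β : Fin n → ℕ) :
    f (jet a α β) = jet (fun j => f (a j)) α β := by
  simp [jet, map_prod]

theorem map_hasse {A' : Type*} [CommRing A'] (f : A →+* A') (d : ℕ) (c : (Fin n → ℕ) → A)
    (a : Fin n → A) (β : Fin n → ℕ) :
    f (hasse d c a β) = hasse d (fun α => f (c α)) (fun j => f (a j)) β := by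
  simp [hasse, map_sum, map_jet]

theorem jet_eq_zero (a : Fin n → A) {α β : Fin n → ℕ} (h : ¬ β ≤ α) : jet a α β = 0 := by
  obtain ⟨j, hj⟩ := not_forall.mp h
  exact Finset.prod_eq_zero (Finset.mem_univ j)
    (by rw [Nat.choose_eq_zero_of_lt (not_le.mp hj), Nat.cast_zero, zero_mul])

theorem jet_zero_right (a : Fin n → A) (α : Fin n → ℕ) : jet a α 0 = mpow a α := by
  simp [jet, mpow]

theorem jet_smul (s : A) (a : Fin n → A) {d m : ℕ} {α β : Fin n → ℕ} (hα : α ∈ expo n d)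
    (hβ : β ∈ expo n m) : jet (s • a) α β = s ^ (d - m) * jet a α β := by
  by_cases h : β ≤ α
  · have : d - m = ∑ j, (α j - β j) := by
      rw [mem_expo] at hα hβ
      rw [Finset.sum_tsub_distrib _ fun j _ => h j, hα, hβ]
    rw [this, ← Finset.prod_pow_eq_pow_sum, jet, jet, ← Finset.prod_mul_distrib]
    refine Finset.prod_congr rfl fun j _ => ?_
    rw [Pi.smul_apply, smul_eq_mul, mul_pow]
    ring
  · rw [jet_eq_zero _ h, jet_eq_zero _ h, mul_zero]

theorem hasse_smul (s : A) (d : ℕ) (c : (Fin n → ℕ) → A) (a : Fin n → A) {m : ℕ}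
    {β : Fin n → ℕ} (hβ : β ∈ expo n m) :
    hasse d c (s • a) β = s ^ (d - m) * hasse d c a β := by
  rw [hasse, hasse, Finset.mul_sum]
  refine Finset.sum_congr rfl fun α hα => ?_
  rw [jet_smul s a hα hβ]
  ring

/-- Euler's relation between the Hasse derivatives of order `|β|` and of order `|β| + 1`. -/
theorem sum_jet_add_single (a : Fin n → A) (α β : Fin n → ℕ) :
    ∑ j, ((β j + 1 : ℕ) : A) * a j * jet a α (β + Pi.single j 1) =
      ∑ j, ((α j - β j : ℕ) : A) * jet a α β := by
  refine Finset.sum_congr rfl fun j _ => ?_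
  rw [jet, jet, ← Finset.mul_prod_erase _ _ (Finset.mem_univ j),
    ← Finset.mul_prod_erase (s := Finset.univ)
      (f := fun i => ((α i).choose (β i) : A) * a i ^ (α i - β i)) (Finset.mem_univ j)]
  have h1 : ∏ x ∈ Finset.univ.erase j, ((α x).choose ((β + Pi.single j 1 : Fin n → ℕ) x) : A) *
      a x ^ (α x - (β + Pi.single j 1 : Fin n → ℕ) x) =
      ∏ x ∈ Finset.univ.erase j, ((α x).choose (β x) : A) * a x ^ (α x - β x) := by
    refine Finset.prod_congr rfl fun x hx => ?_
    simp [Pi.single_eq_of_ne (Finset.ne_of_mem_erase hx)]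
  rw [h1, Pi.add_apply, Pi.single_eq_same]
  have h2 : ((α j).choose (β j + 1) : A) * ((β j + 1 : ℕ) : A) =
      ((α j).choose (β j) : A) * ((α j - β j : ℕ) : A) := by
    exact_mod_cast congrArg (Nat.cast (R := A)) (Nat.choose_succ_right_eq (α j) (β j))
  rcases Nat.lt_or_ge (β j) (α j) with h | h
  · obtain ⟨k, hk⟩ : ∃ k, α j - β j = k + 1 := ⟨α j - β j - 1, by omega⟩
    have hk' : α j - (β j + 1) = k := by omega
    rw [hk] at h2 ⊢
    rw [hk', pow_succ]
    linear_combination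
      a j ^ k * a j * (∏ x ∈ Finset.univ.erase j, ((α x).choose (β x) : A) * a x ^ (α x - β x)) * h2
  · rw [Nat.choose_eq_zero_of_lt (by omega : α j < β j + 1), Nat.sub_eq_zero_of_le h]
    simp

theorem sum_hasse_add_single (d : ℕ) (c : (Fin n → ℕ) → A) (a : Fin n → A) {m : ℕ}
    {β : Fin n → ℕ} (hβ : β ∈ expo n m) :
    ∑ j, ((β j + 1 : ℕ) : A) * a j * hasse d c a (β + Pi.single j 1) =
      ((d - m : ℕ) : A) * hasse d c a β := by
  simp only [hasse, Finset.mul_sum]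
  rw [Finset.sum_comm]
  refine Finset.sum_congr rfl fun α hα => ?_
  have h := sum_jet_add_single a α β
  have h' : ∑ j, ((α j - β j : ℕ) : A) * jet a α β = ((d - m : ℕ) : A) * jet a α β := by
    by_cases hle : β ≤ α
    · rw [mem_expo] at hα hβ
      rw [← Finset.sum_mul, ← Nat.cast_sum, Finset.sum_tsub_distrib _ fun j _ => hle j, hα, hβ]
    · simp [jet_eq_zero _ hle]
  rw [h'] at h
  rw [mul_left_comm, ← h, Finset.mul_sum]
  exact Finset.sum_congr rfl fun j _ => by ring

end

section

variable {K : Type*} [Field K] {n : ℕ}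

/-- The form of degree `d` with coefficients `c`. -/
noncomputable def toForm (d : ℕ) (c : (Fin n → ℕ) → K) : MvPolynomial (Fin n) K :=
  ∑ α ∈ expo n d, MvPolynomial.monomial (Finsupp.equivFunOnFinite.symm α) (c α)

theorem toForm_isHomogeneous (d : ℕ) (c : (Fin n → ℕ) → K) : (toForm d c).IsHomogeneous d := by
  refine MvPolynomial.IsHomogeneous.sum _ _ _ fun α hα => ?_
  refine MvPolynomial.isHomogeneous_monomial _ ?_
  rw [Finsupp.degree_eq_sum]
  exact mem_expo.mp hα

theorem coeff_toForm (d : ℕ) (c : (Fin n → ℕ) → K) {α : Fin n → ℕ} (hα : α ∈ expo n d) :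
    (toForm d c).coeff (Finsupp.equivFunOnFinite.symm α) = c α := by
  classical
  rw [toForm, MvPolynomial.coeff_sum, Finset.sum_eq_single α]
  · rw [MvPolynomial.coeff_monomial, if_pos rfl]
  · intro β _ hβ
    rw [MvPolynomial.coeff_monomial, if_neg]
    exact fun h => hβ (Finsupp.equivFunOnFinite.symm.injective h)
  · exact fun h => absurd hα h

theorem eq_toForm {d : ℕ} {F : MvPolynomial (Fin n) K} (hF : F.IsHomogeneous d) :
    F = toForm d fun α => F.coeff (Finsupp.equivFunOnFinite.symm α) := by
  ext s
  obtain ⟨α, rfl⟩ := Finsupp.equivFunOnFinite.symm.surjective s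
  by_cases hα : α ∈ expo n d
  · rw [coeff_toForm d _ hα]
  · have hdeg : (Finsupp.equivFunOnFinite.symm α : Fin n →₀ ℕ).degree ≠ d := by
      rw [Finsupp.degree_eq_sum]
      exact fun h => hα (mem_expo.mpr h)
    rw [hF.coeff_eq_zero hdeg, (toForm_isHomogeneous d _).coeff_eq_zero hdeg]

theorem eval_toForm (d : ℕ) (c : (Fin n → ℕ) → K) (z : Fin n → K) :
    MvPolynomial.eval z (toForm d c) = ∑ α ∈ expo n d, c α * mpow z α := by
  rw [toForm, map_sum]
  refine Finset.sum_congr rfl fun α _ => ?_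
  rw [MvPolynomial.eval_monomial, Finsupp.prod_fintype _ _ fun j => pow_zero _]
  rfl

/-- A form that vanishes identically has zero coefficients. -/
theorem eq_zero_of_forall_sum_mpow [Infinite K] {d : ℕ} {c : (Fin n → ℕ) → K}
    (h : ∀ z : Fin n → K, ∑ α ∈ expo n d, c α * mpow z α = 0) : ∀ α ∈ expo n d, c α = 0 := by
  intro α hα
  have h0 : toForm d c = 0 := MvPolynomial.funext fun z => by rw [eval_toForm, h, map_zero]
  rw [← coeff_toForm d c hα, h0, MvPolynomial.coeff_zero]

end

/-- Taylor's formula for a monomial. -/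
theorem prod_add_X_mul_pow {K : Type*} [Field K] {n : ℕ} (a v : Fin n → K) (α : Fin n → ℕ) (k : ℕ) :
    (∏ j, (Polynomial.C (a j) + Polynomial.X * Polynomial.C (v j)) ^ α j).coeff k =
      ∑ β ∈ expo n k, jet a α β * mpow v β := by
  classical
  have h : ∀ j, (Polynomial.C (a j) + Polynomial.X * Polynomial.C (v j)) ^ α j =
      ∑ b ∈ Finset.range (α j + 1), Polynomial.C (((α j).choose b : K) * a j ^ (α j - b) * v j ^ b)
          *
        Polynomial.X ^ b := by
    intro j
    rw [add_comm, add_pow]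
    refine Finset.sum_congr rfl fun b _ => ?_
    simp only [mul_pow, Polynomial.C_mul, Polynomial.C_pow, Polynomial.C_eq_natCast]
    ring
  simp only [h]
  rw [Finset.prod_univ_sum, Polynomial.finsetSum_coeff]
  have h2 : ∀ β : Fin n → ℕ, (∏ j, Polynomial.C (((α j).choose (β j) : K) * a j ^ (α j - β j) *
      v j ^ β j) * Polynomial.X ^ β j).coeff k =
      if β ∈ expo n k then jet a α β * mpow v β else 0 := by
    intro β
    rw [Finset.prod_mul_distrib, Finset.prod_pow_eq_pow_sum, ← map_prod, Polynomial.coeff_C_mul,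
      Polynomial.coeff_X_pow, mul_ite, mul_one, mul_zero, Finset.prod_mul_distrib]
    simp only [mem_expo, eq_comm (a := k)]
    rfl
  simp only [h2]
  rw [← Finset.sum_filter]
  refine Finset.sum_subset_zero_on_sdiff ?_ ?_ fun _ _ => rfl
  · intro β hβ
    exact (Finset.mem_filter.mp hβ).2
  · intro β hβ
    rw [Finset.mem_sdiff, Finset.mem_filter, not_and'] at hβ
    rw [jet_eq_zero, zero_mul]
    refine fun hle => hβ.2 hβ.1 (Fintype.mem_piFinset.mpr fun j => ?_)
    exact Finset.mem_range.mpr (Nat.lt_succ_of_le (hle j))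

/-- Taylor's formula: the coefficients of the restriction of a form to a line are given by its Hasse
derivatives. -/
theorem coeff_lineRestriction_toForm {K : Type*} [Field K] {n : ℕ} (d : ℕ)
    (c : (Fin (n + 1) → ℕ) → K) (a v : Fin (n + 1) → K) (k : ℕ) :
    (lineRestriction (toForm d c) a v).coeff k =
      ∑ β ∈ expo (n + 1) k, hasse d c a β * mpow v β := by
  rw [lineRestriction, toForm, map_sum, Polynomial.finsetSum_coeff]
  simp only [hasse, Finset.sum_mul]
  rw [Finset.sum_comm]
  refine Finset.sum_congr rfl fun α _ => ?_
  rw [MvPolynomial.aeval_monomial, Finsupp.prod_fintype _ _ fun j => pow_zero _]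
  change (Polynomial.C (c α) * _).coeff k = _
  rw [Polynomial.coeff_C_mul]
  refine (congrArg (c α * ·) (prod_add_X_mul_pow a v α k)).trans ?_
  rw [Finset.mul_sum]
  exact Finset.sum_congr rfl fun β _ => (mul_assoc _ _ _).symm

/-- A form of degree `d ≥ m` vanishes to order greater than `m` at the point `a` if and only if all
its Hasse derivatives of order exactly `m` vanish there: by Euler's relation, the derivatives of
lower order vanish as well. -/
theorem coeff_lineRestriction_eq_zero_iff {K : Type*} [Field K] [CharZero K] {n d m : ℕ}
    (hmd : m ≤ d) (c : (Fin (n + 1) → ℕ) → K) (a : Fin (n + 1) → K) :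
    (∀ v, ∀ k < m + 1, (lineRestriction (toForm d c) a v).coeff k = 0) ↔
      ∀ β ∈ expo (n + 1) m, hasse d c a β = 0 := by
  simp only [coeff_lineRestriction_toForm]
  constructor
  · exact fun h => eq_zero_of_forall_sum_mpow fun v => h v m (Nat.lt_succ_self m)
  · intro h v k hk
    have key : ∀ i ≤ m, ∀ β ∈ expo (n + 1) (m - i), hasse d c a β = 0 := by
      intro i
      induction i with
      | zero => exact fun _ => h
      | succ i ih =>
        intro hi β hβ
        have hE := sum_hasse_add_single d c a hβ
        rw [Finset.sum_eq_zero] at hE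
        · refine (mul_eq_zero.mp hE.symm).resolve_left (Nat.cast_ne_zero.mpr (by omega))
        · intro j _
          rw [ih (by omega), mul_zero]
          have := add_mem_expo hβ (single_mem_expo j)
          rwa [show m - (i + 1) + 1 = m - i by omega] at this
    refine Finset.sum_eq_zero fun β hβ => ?_
    rw [key (m - k) (by omega) β (by rwa [show m - (m - k) = k by omega]), zero_mul]

/-! ### Openness of rank conditions -/

section

variable {R F : Type*} [CommRing R] [Field F] {m n : Type*} [Fintype m] [Fintype n]
  [DecidableEq m]

/-- Injectivity of a matrix is an open condition on the parameters: if `M` becomes injective under a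
specialization `φ`, then it has a left inverse up to a factor `Δ` that `φ` does not kill. -/
theorem exists_left_inverse_of_specialization [DecidableEq n] {φ : R →+* F}
    (hφ : Function.Surjective φ)
    (M : Matrix m n R) (h : ∀ v : n → F, (M.map φ).mulVec v = 0 → v = 0) :
    ∃ (Δ : R) (C : Matrix n m R), φ Δ = 1 ∧ C * M = Δ • (1 : Matrix n n R) := by
  obtain ⟨g, hg⟩ := LinearMap.exists_leftInverse_of_injective (Matrix.toLin' (M.map φ))
    (LinearMap.ker_eq_bot'.mpr fun v hv => h v (by rwa [Matrix.toLin'_apply] at hv))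
  choose s hs using hφ
  -- lift a left inverse over `F` to `R`, and correct it by the adjugate of the product
  set B : Matrix n m R := (LinearMap.toMatrix' g).map s with hB
  have hBφ : B.map φ = LinearMap.toMatrix' g := by
    ext i j
    simp [hB, hs]
  refine ⟨(B * M).det, (B * M).adjugate * B, ?_, ?_⟩
  · have h1 : (B * M).map φ = 1 := by
      rw [Matrix.map_mul, hBφ, ← LinearMap.toMatrix'_toLin' (M.map φ), ← LinearMap.toMatrix'_comp,
        hg, LinearMap.toMatrix'_id]
    rw [RingHom.map_det, RingHom.mapMatrix_apply, h1, Matrix.det_one]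
  · rw [Matrix.mul_assoc, Matrix.adjugate_mul]

theorem exists_right_inverse_of_specialization [DecidableEq n] {φ : R →+* F}
    (hφ : Function.Surjective φ)
    (M : Matrix m n R) (h : ∀ v : m → F, Matrix.vecMul v (M.map φ) = 0 → v = 0) :
    ∃ (Δ : R) (C : Matrix n m R), φ Δ = 1 ∧ M * C = Δ • (1 : Matrix m m R) := by
  obtain ⟨Δ, C, hΔ, hC⟩ := exists_left_inverse_of_specialization hφ M.transpose fun v hv => h v (by
    rwa [Matrix.transpose_map, Matrix.mulVec_transpose] at hv)
  refine ⟨Δ, C.transpose, hΔ, ?_⟩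
  have := congrArg Matrix.transpose hC
  rwa [Matrix.transpose_mul, Matrix.transpose_transpose, Matrix.transpose_smul,
    Matrix.transpose_one] at this

/-- If `M` is surjective up to the factor `Δ`, then the solutions of the specialized system lift to
solutions over the parameter ring. -/
theorem exists_lift_of_right_inverse {φ : R →+* F} (hφ : Function.Surjective φ)
    {M : Matrix m n R} {Δ : R} {C : Matrix n m R} (hΔ : φ Δ = 1)
    (hC : M * C = Δ • (1 : Matrix m m R)) {f : n → F} (hf : (M.map φ).mulVec f = 0) :
    ∃ w : n → R, M.mulVec w = 0 ∧ ∀ i, φ (w i) = f i := by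
  choose s hs using hφ
  refine ⟨Δ • (fun i => s (f i)) - C.mulVec (M.mulVec fun i => s (f i)), ?_, fun i => ?_⟩
  · rw [Matrix.mulVec_sub, Matrix.mulVec_mulVec, hC, Matrix.mulVec_smul, Matrix.smul_mulVec,
      Matrix.one_mulVec, sub_self]
  · have h1 : φ ∘ (M.mulVec fun i => s (f i)) = 0 := by
      rw [← hf]
      ext j
      simp [Matrix.mulVec, dotProduct, hs]
    have h2 : φ ((C.mulVec (M.mulVec fun i => s (f i))) i) = 0 := by
      rw [Matrix.mulVec, dotProduct, map_sum]
      refine Finset.sum_eq_zero fun j _ => ?_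
      rw [map_mul, show φ (M.mulVec (fun i => s (f i)) j) = 0 from congrFun h1 j, mul_zero]
    rw [Pi.sub_apply, map_sub, h2, sub_zero, Pi.smul_apply, smul_eq_mul, map_mul, hΔ, one_mul, hs]

end

/-! ### Finiteness of zero loci by a Macaulay matrix -/

section

variable {n : ℕ} {J : Type*} {A : Type*} [CommRing A]

/-- The Macaulay matrix in degree `N` of a family of forms `g j` of degrees `deg j` together with
the coordinate `z e`. The columns are the monomials of degree `N`, the rows are the products of
the forms with monomials, followed by the products of `z e` with the monomials of degree `N - 1`.
-/
def macaulay (N : ℕ) (e : Fin n) (deg : J → ℕ) (g : J → (Fin n → ℕ) → A) :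
    Matrix ((Σ j, expo n (N - deg j)) ⊕ expo n (N - 1)) (expo n N) A :=
  Matrix.of fun r β => Sum.elim
    (fun jm : Σ j, expo n (N - deg j) =>
      ∑ α ∈ expo n (deg jm.1), if α + (jm.2 : Fin n → ℕ) = β then g jm.1 α else 0)
    (fun m : expo n (N - 1) => if (m : Fin n → ℕ) + (Pi.single e 1 : Fin n → ℕ) = β then (1 : A)
      else 0) r

theorem macaulay_map {A' : Type*} [CommRing A'] (f : A →+* A') (N : ℕ) (e : Fin n) (deg : J → ℕ)
    (g : J → (Fin n → ℕ) → A) :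
    (macaulay N e deg g).map f = macaulay N e deg fun j α => f (g j α) := by
  ext r β
  rcases r with jm | m
  · simp [macaulay, map_sum, apply_ite f]
  · simp [macaulay, apply_ite f]

theorem sum_expo_ite_eq {N : ℕ} {γ : Fin n → ℕ} (hγ : γ ∈ expo n N) (c : A)
    (V : (Fin n → ℕ) → A) : ∑ β : expo n N, (if γ = β then c else 0) * V β = c * V γ := by
  rw [Finset.sum_eq_single ⟨γ, hγ⟩]
  · simp
  · intro β _ hβ
    rw [if_neg, zero_mul]
    exact fun h => hβ (Subtype.ext h.symm)
  · simp

theorem macaulay_mulVec_inl {N : ℕ} (e : Fin n) {deg : J → ℕ} (hdeg : ∀ j, deg j ≤ N)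
    (g : J → (Fin n → ℕ) → A) (V : (Fin n → ℕ) → A) (j : J) (m : expo n (N - deg j)) :
    (macaulay N e deg g).mulVec (fun β => V β) (Sum.inl ⟨j, m⟩) =
      ∑ α ∈ expo n (deg j), g j α * V (α + m) := by
  simp only [macaulay, Matrix.mulVec, dotProduct, Matrix.of_apply, Sum.elim_inl, Finset.sum_mul]
  rw [Finset.sum_comm]
  refine Finset.sum_congr rfl fun α hα => ?_
  refine sum_expo_ite_eq ?_ _ V
  have := add_mem_expo hα m.2
  rwa [Nat.add_sub_cancel' (hdeg j)] at this

theorem macaulay_mulVec_inr {N : ℕ} (hN : 0 < N) (e : Fin n) (deg : J → ℕ)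
    (g : J → (Fin n → ℕ) → A) (V : (Fin n → ℕ) → A) (m : expo n (N - 1)) :
    (macaulay N e deg g).mulVec (fun β => V β) (Sum.inr m) = V
      ((m : Fin n → ℕ) + Pi.single e 1) := by
  simp only [macaulay, Matrix.mulVec, dotProduct, Matrix.of_apply, Sum.elim_inr]
  rw [sum_expo_ite_eq _ 1 V, one_mul]
  have := add_mem_expo m.2 (single_mem_expo e)
  rwa [Nat.sub_add_cancel hN] at this

end

section

variable {n : ℕ} {J : Type*} [Fintype J] {K : Type*} [Field K] {N : ℕ} {e : Fin n} {deg : J → ℕ}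
  {g : J → (Fin n → ℕ) → K} {Δ : K}
  {C : Matrix (expo n N) ((Σ j, expo n (N - deg j)) ⊕ expo n (N - 1)) K}

/-- If the Macaulay matrix has a left inverse, then at each common zero of the forms the monomials
of degree `N` are combinations of the products of `z e` with the monomials of degree `N - 1`. -/
theorem mpow_eq_sum_of_macaulay (hN : 0 < N) (hdeg : ∀ j, deg j ≤ N)
    (hC : C * macaulay N e deg g = Δ • (1 : Matrix _ _ K)) {z : Fin n → K}
    (hz : ∀ j, ∑ α ∈ expo n (deg j), g j α * mpow z α = 0) (β : expo n N) :
    Δ * mpow z β = z e * ∑ m : expo n (N - 1), C β (Sum.inr m) * mpow z m := by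
  have h := congrFun (congrArg (fun M : Matrix (expo n N) (expo n N) K =>
    M.mulVec fun β : expo n N => mpow z (β : Fin n → ℕ)) hC) β
  simp only [← Matrix.mulVec_mulVec, Matrix.smul_mulVec, Matrix.one_mulVec, Pi.smul_apply,
    smul_eq_mul] at h
  rw [← h, Matrix.mulVec, dotProduct, Fintype.sum_sum_type, Finset.sum_eq_zero, zero_add,
    Finset.mul_sum]
  · refine Finset.sum_congr rfl fun m _ => ?_
    rw [macaulay_mulVec_inr hN, mpow_add, mpow_single]
    ring
  · rintro ⟨j, m⟩ _
    rw [macaulay_mulVec_inl e hdeg]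
    simp only [mpow_add, ← mul_assoc]
    rw [← Finset.sum_mul, hz j, zero_mul, mul_zero]

theorem pow_mem_expo {n : ℕ} (i : Fin n) (N : ℕ) : (Pi.single i N : Fin n → ℕ) ∈ expo n N := by
  simp [mem_expo]

theorem mpow_single_pow {A : Type*} [CommRing A] {n : ℕ} (z : Fin n → A) (i : Fin n) (N : ℕ) :
    mpow z (Pi.single i N) = z i ^ N := by
  rw [mpow, Finset.prod_eq_single i] <;> simp +contextual

/-- If the Macaulay matrix has a left inverse, then the common zeros avoid the hyperplane `z e =
0`. -/
theorem eq_zero_of_macaulay (hN : 0 < N) (hdeg : ∀ j, deg j ≤ N) (hΔ : Δ ≠ 0)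
    (hC : C * macaulay N e deg g = Δ • (1 : Matrix _ _ K)) {z : Fin n → K} (he : z e = 0)
    (hz : ∀ j, ∑ α ∈ expo n (deg j), g j α * mpow z α = 0) : z = 0 := by
  ext i
  have h := mpow_eq_sum_of_macaulay hN hdeg hC hz ⟨_, pow_mem_expo i N⟩
  rw [he, zero_mul] at h
  have := (mul_eq_zero.mp h).resolve_left hΔ
  rw [mpow_single_pow] at this
  exact eq_zero_of_pow_eq_zero this

/-- If the Macaulay matrix has a left inverse, then there are finitely many common zeros: on the
affine chart `z e = 1`, the vector of the monomials of degree `N - 1` is an eigenvector of a fixed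
matrix, with eigenvalue a multiple of the coordinate `z i`. -/
theorem finite_of_macaulay (hN : 0 < N) (hdeg : ∀ j, deg j ≤ N) (hΔ : Δ ≠ 0)
    (hC : C * macaulay N e deg g = Δ • (1 : Matrix _ _ K)) :
    {z : Fin n → K | z e = 1 ∧ ∀ j, ∑ α ∈ expo n (deg j), g j α * mpow z α = 0}.Finite := by
  classical
  have hmem : ∀ (i : Fin n) (m : expo n (N - 1)), (m : Fin n → ℕ) + Pi.single i 1 ∈ expo n N :=
    fun i m => by
      have := add_mem_expo m.2 (single_mem_expo i)
      rwa [Nat.sub_add_cancel hN] at this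
  let T : Fin n → Matrix (expo n (N - 1)) (expo n (N - 1)) K := fun i =>
    Matrix.of fun m m' => C ⟨_, hmem i m⟩ (Sum.inr m')
  have hroots : ∀ i, {t : K | Δ * t ∈ ((T i).charpoly.roots.toFinset : Set K)}.Finite := fun i =>
    (Finset.finite_toSet _).preimage (mul_right_injective₀ hΔ).injOn
  refine (Set.Finite.pi' hroots).subset ?_
  rintro z ⟨hz1, hz⟩ i
  have hne : (fun m : expo n (N - 1) => mpow z m) ≠ 0 := by
    intro h0
    have := congrFun h0 ⟨_, pow_mem_expo e (N - 1)⟩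
    simp [mpow_single_pow, hz1] at this
  have heig : (T i).mulVec (fun m => mpow z m) = (Δ * z i) •
      fun m : expo n (N - 1) => mpow z m := by
    ext m
    have h := mpow_eq_sum_of_macaulay hN hdeg hC hz ⟨_, hmem i m⟩
    rw [hz1, one_mul] at h
    rw [Pi.smul_apply, smul_eq_mul, mul_assoc, mul_comm (z i), ← mpow_single z i, ← mpow_add]
    exact h.symm
  simp only [Set.mem_ofPred_eq, Finset.mem_coe, Multiset.mem_toFinset]
  rw [Polynomial.mem_roots (Matrix.charpoly_monic _).ne_zero, Polynomial.IsRoot,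
    Matrix.eval_charpoly]
  refine Matrix.exists_mulVec_eq_zero_iff.mp ⟨_, hne, ?_⟩
  rw [Matrix.sub_mulVec, heig, Matrix.scalar_apply, ← Matrix.smul_one_eq_diagonal,
    Matrix.smul_mulVec, Matrix.one_mulVec, sub_self]

end

/-! ### Rows of Hasse derivatives as lists of numbers -/

/-- The binomial coefficient, in a form that is cheap to evaluate for small `k`. -/
def fastChoose (n k : ℕ) : ℕ := n.descFactorial k / k.factorial

theorem fastChoose_eq (n k : ℕ) : fastChoose n k = n.choose k :=
  (Nat.choose_eq_descFactorial_div_factorial n k).symm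

/-- For a list of pairs `(tⱼ, aⱼ)`, the values at `t` modulo `p` of the Hasse derivatives of order
`n` of the monomial with exponent `a`, multiplied by `x` and in the order of the list
`List.Nat.antidiagonalTuple`. -/
def jetRow (p : ℕ) : List (ℕ × ℕ) → ℕ → ℕ → List ℕ
  | [], 0, x => [x]
  | [], _ + 1, _ => []
  | [(t, a)], n, x => [x * fastChoose a n * t ^ (a - n) % p]
  | (t, a) :: l, n, x => (List.range (n + 1)).flatMap fun b =>
      withValue (x * fastChoose a b * t ^ (a - b) % p) fun y => jetRow p l (n - b) y

theorem jet_succ {A : Type*} [CommRing A] {n : ℕ} (a : Fin (n + 1) → A) (α β : Fin (n + 1) → ℕ) :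
    jet a α β = ((α 0).choose (β 0) * a 0 ^ (α 0 - β 0)) *
      jet (fun i => a i.succ) (fun i => α i.succ) (fun i => β i.succ) := by
  rw [jet, Fin.prod_univ_succ]
  rfl

theorem antidiagonalTuple_succ (k n : ℕ) :
    List.Nat.antidiagonalTuple (k + 1) n = (List.range (n + 1)).flatMap fun b =>
      (List.Nat.antidiagonalTuple k (n - b)).map fun β => Fin.cons b β := by
  rw [List.Nat.antidiagonalTuple, List.Nat.antidiagonal, List.flatMap_map]

theorem jetRow_map_cast (p : ℕ) (l : List (ℕ × ℕ)) (n x : ℕ) :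
    (jetRow p l n x).map (Nat.cast : ℕ → ZMod p) =
      (List.Nat.antidiagonalTuple l.length n).map fun β =>
        (x : ZMod p) * jet (fun i => ((l.get i).1 : ZMod p)) (fun i => (l.get i).2) β := by
  induction l generalizing n x with
  | nil =>
    cases n with
    | zero => simp [jetRow, jet]
    | succ n => simp [jetRow]
  | cons ta l ih =>
    obtain ⟨t, a⟩ := ta
    cases l with
    | nil => simp [jetRow, jet, List.Nat.antidiagonalTuple_one, fastChoose_eq, mul_assoc]
    | cons tb l =>
      rw [jetRow, List.map_flatMap]
      · refine Eq.trans ?_ (congrArg (List.map _) (antidiagonalTuple_succ (l.length + 1) n)).symm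
        rw [List.map_flatMap]
        congr 1
        ext1 b
        rw [withValue_eq, ih, List.map_map]
        refine List.map_congr_left fun β _ => ?_
        have h : jet (fun i => ((((t, a) :: tb :: l).get i).1 : ZMod p))
            (fun i => (((t, a) :: tb :: l).get i).2) (Fin.cons b β : Fin (l.length + 2) → ℕ) =
            (a.choose b * t ^ (a - b)) * jet (fun i => (((tb :: l).get i).1 : ZMod p))
              (fun i => ((tb :: l).get i).2) β :=
          jet_succ (n := l.length + 1) _ _ _
        rw [ZMod.natCast_mod, fastChoose_eq, Function.comp_apply]
        push_cast
        refine Eq.trans ?_ (congrArg ((x : ZMod p) * ·) h.symm)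
        ring
      · simp

/-- The linear combination of the rows `f γ` with the given coefficients, modulo `p`. -/
def combineRows {X : Type*} (p len : ℕ) (f : X → List ℕ) : List (X × ℕ) → List ℕ
  | [] => List.replicate len 0
  | (γ, c) :: l => List.zipWith (fun x y => (c * x + y) % p) (f γ) (combineRows p len f l)

theorem combineRows_map_cast {X Y : Type*} {p : ℕ} (f : X → List ℕ) (B : List Y)
    (J : X → Y → ZMod p) (h : ∀ γ, (f γ).map (Nat.cast : ℕ → ZMod p) = B.map (J γ))
    (l : List (X × ℕ)) :
    (combineRows p B.length f l).map (Nat.cast : ℕ → ZMod p) =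
      B.map fun β => (l.map fun γc => (γc.2 : ZMod p) * J γc.1 β).sum := by
  induction l with
  | nil => simp [combineRows, List.map_replicate]
  | cons γc l ih =>
    obtain ⟨γ, c⟩ := γc
    rw [combineRows, List.map_zipWith]
    simp only [ZMod.natCast_mod, Nat.cast_add, Nat.cast_mul, List.map_cons, List.sum_cons]
    have hz : ∀ (l₁ l₂ : List ℕ),
        List.zipWith (fun x y : ℕ => (c : ZMod p) * (x : ZMod p) + (y : ZMod p)) l₁ l₂ =
        List.zipWith (fun x y : ZMod p => c * x + y) (l₁.map (Nat.cast : ℕ → ZMod p))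
          (l₂.map (Nat.cast : ℕ → ZMod p)) := by
      intro l₁ l₂
      rw [List.zipWith_map]
    rw [hz, h, ih, List.zipWith_map, List.zipWith_self]

theorem sum_range_getD_mul {X : Type*} {p : ℕ} (l : List ℕ) (B : List X) (J f : X → ZMod p) (x₀ : X)
    (h : l.map (Nat.cast : ℕ → ZMod p) = B.map J) :
    ∑ i ∈ Finset.range l.length, (l.getD i 0 : ZMod p) * f (B.getD i x₀) =
      (B.map fun x => J x * f x).sum := by
  induction l generalizing B with
  | nil =>
    cases B with
    | nil => simp
    | cons _ _ => simp at h
  | cons a l ih =>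
    cases B with
    | nil => simp at h
    | cons b B =>
      simp only [List.map_cons, List.cons.injEq] at h
      rw [List.length_cons, Finset.sum_range_succ']
      simp only [List.getD_cons_succ, List.getD_cons_zero, List.map_cons, List.sum_cons, ih B h.2,
          h.1]
      rw [add_comm]

theorem sum_expo_eq_list_sum {A : Type*} [AddCommMonoid A] (n d : ℕ) (f : (Fin n → ℕ) → A) :
    ∑ α ∈ expo n d, f α = ((List.Nat.antidiagonalTuple n d).map f).sum := rfl

theorem mem_expo_iff_mem_list {n d : ℕ} {α : Fin n → ℕ} :
    α ∈ expo n d ↔ α ∈ List.Nat.antidiagonalTuple n d := by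
  rw [mem_expo, List.Nat.mem_antidiagonalTuple]

/-! ### Fourteen special points modulo `29` -/

instance fact_prime_twentyNine : Fact (Nat.Prime 29) := ⟨by norm_num⟩

/-- The representatives of the two orbits of special points. -/
def basePt (s : Fin 2) : Fin 5 → ℕ := if s = 0 then ![1, 1, 1, 2, 1] else ![1, 2, 1, 3, 1]

/-- The weights of the coordinates under the action of the cyclic group of order `7`. -/
def coordWeight : Fin 5 → ℕ := ![0, 1, 2, 5, 6]

/-- The weight of the monomial with exponent `α`. -/
def expWeight (α : Fin 5 → ℕ) : ℕ := α 1 + 2 * α 2 + 5 * α 3 + 6 * α 4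

theorem expWeight_eq_sum (α : Fin 5 → ℕ) : expWeight α = ∑ j, coordWeight j * α j := by
  simp [expWeight, coordWeight, Fin.sum_univ_five]

/-- The indexing of the special points by orbits and group elements. -/
def pointIndex : Fin 2 × Fin 7 ≃ Fin 14 := finProdFinEquiv

/-- The point with index `7 s + k`: the image of `basePt s` under the `k`-th power of the diagonal
matrix with entries `7 ^ coordWeight j`, where `7` is an element of order `7` modulo `29`. -/
def specialPt (i : Fin 14) (j : Fin 5) : ZMod 29 :=
  let sk := pointIndex.symm i
  7 ^ (sk.2 * coordWeight j : ℕ) * basePt sk.1 j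

theorem specialPt_pointIndex (s : Fin 2) (k : Fin 7) :
    specialPt (pointIndex (s, k)) =
      fun j => 7 ^ (k * coordWeight j : ℕ) * (basePt s j : ZMod 29) := by
  ext j
  simp only [specialPt, Equiv.symm_apply_apply]

theorem seven_pow_seven_mul (a : ℕ) : (7 : ZMod 29) ^ (7 * a) = 1 := by
  rw [pow_mul, show (7 : ZMod 29) ^ 7 = 1 by decide, one_pow]

theorem jet_specialPt (s : Fin 2) (k : Fin 7) (α β : Fin 5 → ℕ) :
    jet (specialPt (pointIndex (s, k))) α β =
      7 ^ (k * (expWeight α + 6 * expWeight β) : ℕ) *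
        jet (fun j => (basePt s j : ZMod 29)) α β := by
  by_cases h : β ≤ α
  · have hw : expWeight α + 6 * expWeight β =
        ∑ j, coordWeight j * (α j - β j) + 7 * expWeight β := by
      have : expWeight α = ∑ j, coordWeight j * (α j - β j) + expWeight β := by
        rw [expWeight_eq_sum, expWeight_eq_sum, ← Finset.sum_add_distrib]
        refine Finset.sum_congr rfl fun j _ => ?_
        rw [← mul_add, Nat.sub_add_cancel (h j)]
      omega
    rw [hw, mul_add, mul_left_comm, pow_add, seven_pow_seven_mul, mul_one, Finset.mul_sum,
      ← Finset.prod_pow_eq_pow_sum, specialPt_pointIndex, jet, jet, ← Finset.prod_mul_distrib]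
    refine Finset.prod_congr rfl fun j _ => ?_
    rw [mul_pow, ← pow_mul, mul_assoc (k : ℕ)]
    ring
  · rw [jet_eq_zero _ h, jet_eq_zero _ h, mul_zero]

/-- The values of the Hasse derivatives of order `m` of the monomial with exponent `α` at the two
representatives. -/
def orbitRow (m : ℕ) (α : Fin 5 → ℕ) : List ℕ :=
  withValue (α 0) fun a₀ => withValue (α 1) fun a₁ => withValue (α 2) fun a₂ =>
  withValue (α 3) fun a₃ => withValue (α 4) fun a₄ =>
    jetRow 29 [(1, a₀), (1, a₁), (1, a₂), (2, a₃), (1, a₄)] m 1 ++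
    jetRow 29 [(1, a₀), (2, a₁), (1, a₂), (3, a₃), (1, a₄)] m 1

/-- The pairs of an orbit and a derivative of order `m`, in the order used by `orbitRow`. -/
def derivIndex (m : ℕ) : List (Fin 2 × (Fin 5 → ℕ)) :=
  (List.Nat.antidiagonalTuple 5 m).map (fun β => (0, β)) ++
  (List.Nat.antidiagonalTuple 5 m).map (fun β => (1, β))

theorem mem_derivIndex {m : ℕ} (s : Fin 2) {β : Fin 5 → ℕ} (hβ : β ∈ expo 5 m) :
    (s, β) ∈ derivIndex m := by
  have := mem_expo_iff_mem_list.mp hβ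
  fin_cases s <;> simp [derivIndex, this]

theorem orbitRow_map_cast (m : ℕ) (α : Fin 5 → ℕ) :
    (orbitRow m α).map (Nat.cast : ℕ → ZMod 29) =
      (derivIndex m).map fun sβ => jet (fun j => (basePt sβ.1 j : ZMod 29)) α sβ.2 := by
  simp only [orbitRow, withValue_eq, List.map_append, jetRow_map_cast, Nat.cast_one, one_mul,
    derivIndex, List.map_map]
  congr 1

/-! ### Independence of the multiplicity conditions at the special points -/

/-- The matrix of the conditions that a form of degree `d` has vanishing Hasse derivatives of order
`m` at the points `x i`. -/
def condMatrix {A : Type*} [CommRing A] {ι : Type*} {n : ℕ} (d m : ℕ) (x : ι → Fin n → A) :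
    Matrix (ι × expo n m) (expo n d) A :=
  Matrix.of fun r α => jet (x r.1) α r.2

theorem condMatrix_map {A A' : Type*} [CommRing A] [CommRing A'] (f : A →+* A') {ι : Type*} {n : ℕ}
    (d m : ℕ) (x : ι → Fin n → A) :
    (condMatrix d m x).map f = condMatrix d m fun i j => f (x i j) := by
  ext r α
  exact map_jet f _ _ _

theorem condMatrix_mulVec {A : Type*} [CommRing A] {ι : Type*} {n : ℕ} (d m : ℕ)
    (x : ι → Fin n → A) (c : (Fin n → ℕ) → A) (r : ι × expo n m) :
    (condMatrix d m x).mulVec (fun α => c α) r = hasse d c (x r.1) r.2 := by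
  rw [hasse, ← Finset.sum_coe_sort, Matrix.mulVec, dotProduct]
  refine Finset.sum_congr rfl fun α _ => ?_
  rw [mul_comm, condMatrix, Matrix.of_apply]

/-- The equations coming from the monomials of weight `w` modulo `7`. -/
def weightBlockRows (d m w : ℕ) : List ℕ :=
  ((List.Nat.antidiagonalTuple 5 d).filter fun α => expWeight α % 7 == w).map fun α =>
    packDense 29 (2 ^ 20) (orbitRow m α)

/-- The check that the conditions of each weight are independent. -/
def weightBlocksIndependent (d m : ℕ) : Bool :=
  (List.range 7).all fun w =>
    eliminate 29 (2 ^ 20) (2 * (List.Nat.antidiagonalTuple 5 m).length) (weightBlockRows d m w)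

theorem orbitRow_length (m : ℕ) (α : Fin 5 → ℕ) :
    (orbitRow m α).length = 2 * (List.Nat.antidiagonalTuple 5 m).length := by
  have h := congrArg List.length (orbitRow_map_cast m α)
  simpa [two_mul, derivIndex] using h

theorem eq_zero_of_weightBlocksIndependent {d m : ℕ} (h : weightBlocksIndependent d m = true)
    (hm : 29 + 2 * (List.Nat.antidiagonalTuple 5 m).length * (29 * 29) < 2 ^ 20)
    {w : ℕ} (hw : w < 7) (ν : Fin 2 → (Fin 5 → ℕ) → ZMod 29)
    (hν : ∀ α ∈ expo 5 d, expWeight α % 7 = w →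
      ∑ s, ∑ β ∈ expo 5 m, ν s β * jet (fun j => (basePt s j : ZMod 29)) α β = 0) :
    ∀ s, ∀ β ∈ expo 5 m, ν s β = 0 := by
  let v : ℕ → ZMod 29 := fun k =>
    (fun sβ : Fin 2 × (Fin 5 → ℕ) => ν sβ.1 sβ.2) ((derivIndex m).getD k (0, 0))
  have hB : (derivIndex m).length = 2 * (List.Nat.antidiagonalTuple 5 m).length := by
    simp [derivIndex, two_mul]
  have hv : ∀ i < 2 * (List.Nat.antidiagonalTuple 5 m).length, v i = 0 := by
    refine eliminate_sound (b := 29) (rows := weightBlockRows d m w) _ ?_ hm ?_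
    · exact List.all_eq_true.mp h w (List.mem_range.mpr hw)
    · intro r hr
      obtain ⟨α, hα, rfl⟩ := List.mem_map.mp hr
      obtain ⟨hα, hαw⟩ := List.mem_filter.mp hα
      rw [← orbitRow_length m α]
      refine packedRelation_packDense _ _ _ ?_
      have hsum := sum_range_getD_mul (orbitRow m α) (derivIndex m)
        (fun sβ => jet (fun j => (basePt sβ.1 j : ZMod 29)) α sβ.2)
        (fun sβ => ν sβ.1 sβ.2) (0, 0) (orbitRow_map_cast m α)
      rw [hsum, derivIndex, List.map_append, List.sum_append, List.map_map, List.map_map]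
      have := hν α (mem_expo_iff_mem_list.mpr hα) (by simpa using hαw)
      rw [Fin.sum_univ_two, sum_expo_eq_list_sum, sum_expo_eq_list_sum] at this
      rw [← this]
      congr 3 <;> funext β <;> exact mul_comm _ _
  intro s β hβ
  obtain ⟨i, hi, hiB⟩ := List.getElem_of_mem (mem_derivIndex s hβ)
  have := hv i (hB ▸ hi)
  simp only [v, List.getD_eq_getElem _ _ hi, hiB] at this
  exact this

/-- The conditions at the special points are independent if they are so weight by weight: the group
acts on the conditions, and the sums of conditions over an orbit with the values of a character as
coefficients involve only monomials of one weight. -/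
theorem vecMul_condMatrix_specialPt_injective {d m : ℕ} (h : weightBlocksIndependent d m = true)
    (hm : 29 + 2 * (List.Nat.antidiagonalTuple 5 m).length * (29 * 29) < 2 ^ 20)
    (c : Fin 14 × expo 5 m → ZMod 29)
    (hc : Matrix.vecMul c (condMatrix d m specialPt) = 0) : c = 0 := by
  classical
  -- the coefficients, as a function of the orbit, the group element and the derivative
  let b : Fin 2 → Fin 7 → (Fin 5 → ℕ) → ZMod 29 := fun s k β =>
    if hβ : β ∈ expo 5 m then c (pointIndex (s, k), ⟨β, hβ⟩) else 0
  -- their discrete Fourier transform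
  let μ : Fin 2 → (Fin 5 → ℕ) → ℕ → ZMod 29 := fun s β e => ∑ k : Fin 7, b s k β * 7 ^ (k * e : ℕ)
  have hμ : ∀ s β e e', e ≡ e' [MOD 7] → μ s β e = μ s β e' := by
    intro s β e e' he
    refine Finset.sum_congr rfl fun k _ => ?_
    congr 1
    have h7 : ∀ f : ℕ, (7 : ZMod 29) ^ f = 7 ^ (f % 7) := fun f => by
      conv_lhs => rw [← Nat.div_add_mod f 7, pow_add, seven_pow_seven_mul, one_mul]
    rw [h7, h7 (k * e'), Nat.ModEq.mul_left (k : ℕ) he]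
  have hsum : ∀ α ∈ expo 5 d, ∑ s, ∑ β ∈ expo 5 m,
      μ s β (expWeight α + 6 * expWeight β) * jet (fun j => (basePt s j : ZMod 29)) α β = 0 := by
    intro α hα
    have h0 := congrFun hc ⟨α, hα⟩
    rw [Pi.zero_apply, Matrix.vecMul, dotProduct, Fintype.sum_prod_type,
      ← Equiv.sum_comp pointIndex, Fintype.sum_prod_type] at h0
    rw [← h0]
    refine Finset.sum_congr rfl fun s _ => ?_
    simp only [μ, Finset.sum_mul]
    rw [Finset.sum_comm]
    refine Finset.sum_congr rfl fun k _ => ?_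
    rw [← Finset.sum_coe_sort (expo 5 m)]
    refine Finset.sum_congr rfl fun β _ => ?_
    simp only [b, condMatrix, Matrix.of_apply]
    rw [dif_pos β.2, jet_specialPt]
    ring
  have hzero : ∀ s, ∀ β ∈ expo 5 m, ∀ e, μ s β e = 0 := by
    intro s β hβ e
    set w := (e + expWeight β) % 7 with hw
    have := eq_zero_of_weightBlocksIndependent h hm (w := w) (Nat.mod_lt _ (by norm_num))
      (fun s β => μ s β (w + 6 * expWeight β)) (fun α hα hαw => by
        rw [← hsum α hα]
        refine Finset.sum_congr rfl fun s _ => Finset.sum_congr rfl fun β _ => ?_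
        rw [hμ s β (w + 6 * expWeight β) (expWeight α + 6 * expWeight β)]
        exact Nat.ModEq.add_right _ (by rw [← hαw]; exact Nat.mod_modEq _ _)) s β hβ
    rw [← this]
    refine hμ s β _ _ ?_
    have h1 : w ≡ e + expWeight β [MOD 7] := Nat.mod_modEq _ _
    have h2 := h1.add_right (6 * expWeight β)
    refine Nat.ModEq.trans ?_ h2.symm
    rw [show e + expWeight β + 6 * expWeight β = e + 7 * expWeight β by ring]
    exact (Nat.add_mul_mod_self_left e 7 _).symm
  have hb : ∀ s, ∀ β ∈ expo 5 m, ∀ k, b s k β = 0 := by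
    intro s β hβ
    have hinj : Function.Injective fun k : Fin 7 => (7 : ZMod 29) ^ (k : ℕ) := by decide
    have := Matrix.eq_zero_of_forall_pow_sum_mul_pow_eq_zero
        (f := fun k : Fin 7 => (7 : ZMod 29) ^ (k : ℕ))
      (v := fun k => b s k β) hinj fun i => by
        rw [← hzero s β hβ i]
        refine Finset.sum_congr rfl fun k _ => ?_
        rw [pow_mul]
    exact fun k => congrFun this k
  ext ⟨i, β⟩
  obtain ⟨⟨s, k⟩, rfl⟩ := pointIndex.surjective i
  have := hb s β β.2 k
  simp only [b, dif_pos β.2] at this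
  exact this

set_option maxRecDepth 100000 in
theorem weightBlocksIndependent_two_zero : weightBlocksIndependent 2 0 = true := by
  decide +kernel

set_option maxRecDepth 100000 in
theorem weightBlocksIndependent_eight_three : weightBlocksIndependent 8 3 = true := by
  decide +kernel

/-! ### The quadric and the octics through the special points -/

/-- The coefficient of the monomial with exponent `α` in the polynomial modulo `29` given as a list
of exponents with coefficients. -/
def termCoeff (l : List ((Fin 5 → ℕ) × ℕ)) (α : Fin 5 → ℕ) : ZMod 29 :=
  (l.map fun γc => if γc.1 = α then (γc.2 : ZMod 29) else 0).sum

theorem sum_termCoeff_mul {d : ℕ} {l : List ((Fin 5 → ℕ) × ℕ)} (hl : ∀ γc ∈ l, γc.1 ∈ expo 5 d)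
    (f : (Fin 5 → ℕ) → ZMod 29) :
    ∑ α ∈ expo 5 d, termCoeff l α * f α = (l.map fun γc => (γc.2 : ZMod 29) * f γc.1).sum := by
  induction l with
  | nil => simp [termCoeff]
  | cons γc l ih =>
    have h1 : ∀ α, termCoeff (γc :: l) α = (if γc.1 = α then (γc.2 : ZMod 29) else 0) +
        termCoeff l α := fun α => by simp [termCoeff]
    simp only [h1, add_mul, Finset.sum_add_distrib, ih fun x hx => hl x (List.mem_cons_of_mem _ hx),
      ite_mul, zero_mul, Finset.sum_ite_eq, if_pos (hl γc List.mem_cons_self), List.map_cons,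
      List.sum_cons]

/-- The check that a form vanishes at the orbit representatives together with its Hasse derivatives
of order `m`. -/
def hasVanishingJets (m : ℕ) (l : List ((Fin 5 → ℕ) × ℕ)) : Bool :=
  (combineRows 29 (derivIndex m).length (orbitRow m) l).all (· == 0)

/-- A form all of whose monomials have the same weight modulo `7` satisfies the multiplicity
conditions on an orbit as soon as it satisfies them at one point of it. -/
theorem hasse_specialPt_eq_zero {d m w : ℕ} {l : List ((Fin 5 → ℕ) × ℕ)}
    (hl : ∀ γc ∈ l, γc.1 ∈ expo 5 d) (hw : ∀ γc ∈ l, expWeight γc.1 % 7 = w)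
    (h : hasVanishingJets m l = true) (i : Fin 14) {β : Fin 5 → ℕ} (hβ : β ∈ expo 5 m) :
    hasse d (termCoeff l) (specialPt i) β = 0 := by
  obtain ⟨⟨s, k⟩, rfl⟩ := pointIndex.surjective i
  have hbase : (l.map fun γc => (γc.2 : ZMod 29) *
      jet (fun j => (basePt s j : ZMod 29)) γc.1 β).sum = 0 := by
    have hrow := combineRows_map_cast (p := 29) (orbitRow m) (derivIndex m)
      (fun γ sβ => jet (fun j => (basePt sβ.1 j : ZMod 29)) γ sβ.2) (orbitRow_map_cast m) l
    have hmem := List.mem_map_of_mem (f := fun sβ : Fin 2 × (Fin 5 → ℕ) =>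
      (l.map fun γc => (γc.2 : ZMod 29) * jet (fun j => (basePt sβ.1 j : ZMod 29)) γc.1 sβ.2).sum)
      (mem_derivIndex s hβ)
    rw [← hrow] at hmem
    obtain ⟨x, hx, hx'⟩ := List.mem_map.mp hmem
    have := List.all_eq_true.mp h x hx
    rw [beq_iff_eq] at this
    rw [← hx', this, Nat.cast_zero]
  rw [hasse, sum_termCoeff_mul hl]
  have hmap : (l.map fun γc => (γc.2 : ZMod 29) * jet (specialPt (pointIndex (s, k))) γc.1 β) =
      (l.map fun γc => 7 ^ (k * (w + 6 * expWeight β) : ℕ) * ((γc.2 : ZMod 29) *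
      jet (fun j => (basePt s j : ZMod 29)) γc.1 β)) := by
    refine List.map_congr_left fun γc hγc => ?_
    have h7 : (7 : ZMod 29) ^ (k * (expWeight γc.1 + 6 * expWeight β) : ℕ) =
        7 ^ (k * (w + 6 * expWeight β) : ℕ) := by
      rw [← hw γc hγc]
      conv_lhs => rw [← Nat.div_add_mod (expWeight γc.1) 7, add_assoc, mul_add, mul_left_comm,
        pow_add, seven_pow_seven_mul, one_mul]
    rw [jet_specialPt, h7]
    ring
  rw [hmap, List.sum_map_mul_left, hbase, mul_zero]

/-- The quadric `x₁ x₄ - x₂ x₃ + x₀²` through the special points. -/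
def quadricTerms : List ((Fin 5 → ℕ) × ℕ) :=
  [(![0, 1, 0, 0, 1], 1), (![0, 0, 1, 1, 0], 28), (![2, 0, 0, 0, 0], 1)]

/-- The weights modulo `7` of the four octics. -/
def sectionWeight : Fin 4 → ℕ := ![1, 2, 5, 6]

/-- The coefficients of the octics of multiplicity `4` at the special points, one of each weight
`1`, `2`, `5`, `6`. They belong to the monomials of this weight in lexicographic order. -/
def sectionTable : Fin 4 → List ℕ
  | 0 => [
      14, 11, 5, 10, 12, 24, 16, 6, 24, 21, 8, 7, 15, 21, 19, 28, 6, 21, 25, 0, 11, 21, 9, 17,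
      16, 6, 8, 25, 3, 14, 23, 23, 7, 11, 8, 1, 8, 8, 26, 3, 2, 23, 25, 23, 22, 25, 15, 2, 28,
      28, 0, 9, 21, 9, 13, 0, 6, 12, 23, 10, 24, 28, 15, 11, 6, 7, 2, 11, 16, 5, 1]
  | 1 => [
      20, 3, 2, 25, 8, 18, 18, 7, 27, 24, 22, 3, 17, 4, 6, 7, 25, 1, 5, 18, 8, 13, 14, 22, 9,
      24, 17, 24, 24, 18, 17, 3, 27, 23, 23, 22, 5, 4, 12, 20, 7, 26, 20, 17, 2, 19, 2, 7, 4, 3,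
      15, 8, 2, 21, 21, 0, 7, 23, 17, 6, 21, 27, 9, 9, 4, 23, 12, 21, 13, 3, 1]
  | 2 => [
      1, 3, 1, 1, 13, 3, 13, 8, 0, 5, 25, 7, 6, 25, 21, 6, 21, 28, 24, 6, 10, 3, 5, 12, 14, 18,
      10, 24, 22, 22, 9, 3, 6, 9, 23, 0, 28, 13, 10, 27, 20, 28, 22, 3, 7, 17, 23, 21, 9, 9, 15,
      25, 27, 4, 26, 23, 20, 25, 22, 22, 11, 2, 28, 14, 12, 27, 0, 23, 6, 2, 1]
  | 3 => [
      6, 12, 0, 19, 16, 26, 8, 23, 12, 4, 3, 21, 0, 19, 10, 4, 6, 23, 16, 14, 14, 14, 26, 6, 25,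
      22, 9, 6, 27, 9, 21, 11, 4, 7, 10, 11, 23, 23, 20, 10, 18, 13, 12, 6, 11, 7, 18, 10, 26,
      25, 8, 0, 27, 9, 4, 5, 28, 23, 25, 0, 16, 22, 8, 6, 2, 7, 19, 25, 10, 28, 1]

/-- The octics of multiplicity `4` at the special points. -/
def sectionTerms (w : Fin 4) : List ((Fin 5 → ℕ) × ℕ) :=
  ((List.Nat.antidiagonalTuple 5 8).filter fun α => expWeight α % 7 == sectionWeight w).zip
    (sectionTable w)

theorem mem_expo_of_mem_quadricTerms : ∀ γc ∈ quadricTerms, γc.1 ∈ expo 5 2 := by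
  simp [quadricTerms, mem_expo, Fin.sum_univ_five]

theorem expWeight_of_mem_quadricTerms : ∀ γc ∈ quadricTerms, expWeight γc.1 % 7 = 0 := by
  simp [quadricTerms, expWeight]

theorem mem_expo_of_mem_sectionTerms (w : Fin 4) : ∀ γc ∈ sectionTerms w, γc.1 ∈ expo 5 8 :=
  fun _ h => mem_expo_iff_mem_list.mpr (List.mem_filter.mp (List.of_mem_zip h).1).1

theorem expWeight_of_mem_sectionTerms (w : Fin 4) :
    ∀ γc ∈ sectionTerms w, expWeight γc.1 % 7 = sectionWeight w :=
  fun γc h => by simpa using (List.mem_filter.mp (List.of_mem_zip h).1).2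

set_option maxRecDepth 100000 in
theorem hasVanishingJets_quadricTerms : hasVanishingJets 0 quadricTerms = true := by
  decide +kernel

set_option maxRecDepth 100000 in
theorem hasVanishingJets_sectionTerms : ∀ w, hasVanishingJets 3 (sectionTerms w) = true := by
  decide +kernel

/-! ### The octics on the hyperplane `x₀ = 0` -/

/-- The check that the given sparse rows are linearly independent modulo `29` in the sense that only
the zero vector of length `n` is annihilated by all of them. -/
def sparseRowsInjective (n : ℕ) (rows : List (List (ℕ × ℕ))) : Bool :=
  rows.all (fun l => l.all (fun kc => decide (kc.1 < n)) &&
    decide ((l.map Prod.snd).sum + n * (29 * 29) < 2 ^ 20)) &&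
  eliminate 29 (2 ^ 20) n (rows.map (packSparse (2 ^ 20)))

theorem PackedRelation.mono {p B n b b' r : ℕ} {v : ℕ → ZMod p} (h : PackedRelation p B n b r v)
    (hb : b ≤ b') : PackedRelation p B n b' r v :=
  let ⟨L, h1, h2, h3⟩ := h
  ⟨L, h1, fun i => (h2 i).trans hb, h3⟩

theorem eq_zero_of_sparseRowsInjective {n : ℕ} {rows : List (List (ℕ × ℕ))}
    (h : sparseRowsInjective n rows = true) (hn : n * (29 * 29) < 2 ^ 20) (v : ℕ → ZMod 29)
    (hv : ∀ l ∈ rows, (l.map fun kc => (kc.2 : ZMod 29) * v kc.1).sum = 0) : ∀ i < n, v i = 0 := by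
  rw [sparseRowsInjective, Bool.and_eq_true, List.all_eq_true] at h
  refine eliminate_sound n (b := 2 ^ 20 - 1 - n * (29 * 29)) h.2 (by omega) ?_
  intro r hr
  obtain ⟨l, hl, rfl⟩ := List.mem_map.mp hr
  have h1 := h.1 l hl
  rw [Bool.and_eq_true, List.all_eq_true, decide_eq_true_eq] at h1
  exact (packedRelation_packSparse l v (fun kc hkc => of_decide_eq_true (h1.1 kc hkc))
    (hv l hl)).mono (by omega)

/-- On the quadric surface `x₁ x₄ = x₂ x₃` in the hyperplane `x₀ = 0`, parametrized by
`x₁ = s u`, `x₂ = s u'`, `x₃ = s' u`, `x₄ = s' u'`, an octic becomes a form of bidegree `(8, 8)`.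
Here are its terms, multiplied by `s ^ a u ^ b`, where `s ^ i u ^ j` has the index `i + 16 j`. -/
def bihomogeneousRow (l : List ((Fin 5 → ℕ) × ℕ)) (a b : ℕ) : List (ℕ × ℕ) :=
  (l.filter fun γc => γc.1 0 == 0).map fun γc =>
    (γc.1 1 + γc.1 2 + a + 16 * (γc.1 1 + γc.1 3 + b), γc.2)

/-- All the multiples of bidegree `(15, 15)` of the octics by monomials. -/
def bihomogeneousRows : List (List (ℕ × ℕ)) :=
  (List.finRange 4).flatMap fun w => (List.range 8).flatMap fun a => (List.range 8).map fun b =>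
    bihomogeneousRow (sectionTerms w) a b

set_option maxRecDepth 100000 in
theorem sparseRowsInjective_bihomogeneousRows :
    sparseRowsInjective 256 bihomogeneousRows = true := by
  decide +kernel

/-- Every vector indexed by monomials of degree `N` is the restriction of a function on exponents.
-/
theorem exists_extension {A : Type*} [Zero A] {n N : ℕ} (v : expo n N → A) :
    ∃ V : (Fin n → ℕ) → A, v = fun β : expo n N => V β := by
  classical
  exact ⟨fun α => if h : α ∈ expo n N then v ⟨α, h⟩ else 0, by ext β; simp⟩

/-- In the kernel of the Macaulay matrix, the entries at the multiples of the coordinate `z e`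
vanish. -/
theorem eq_zero_of_macaulay_mulVec_eq_zero {n : ℕ} {J A : Type*} [CommRing A] {N : ℕ} (hN : 0 < N)
    {e : Fin n} {deg : J → ℕ} {g : J → (Fin n → ℕ) → A} {V : (Fin n → ℕ) → A}
    (hV : (macaulay N e deg g).mulVec (fun β => V β) = 0) {α : Fin n → ℕ} (hα : α ∈ expo n N)
    (he : α e ≠ 0) : V α = 0 := by
  have hsub : α - Pi.single e 1 + Pi.single e 1 = α := by
    refine tsub_add_cancel_of_le fun j => ?_
    by_cases hj : j = e
    · subst hj; simpa using Nat.one_le_iff_ne_zero.mpr he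
    · simp [Pi.single_eq_of_ne hj]
  have hmem : α - Pi.single e 1 ∈ expo n (N - 1) := by
    rw [mem_expo] at hα ⊢
    have : ∑ j, (α - Pi.single e 1 + Pi.single e 1 : Fin n → ℕ) j = N := by rw [hsub, hα]
    simp only [Pi.add_apply, Finset.sum_add_distrib, Finset.sum_pi_single', Finset.mem_univ,
      if_true] at this
    omega
  have h := congrFun hV (Sum.inr ⟨_, hmem⟩)
  rw [macaulay_mulVec_inr hN] at h
  simpa [hsub] using h

theorem sum_map_filter_of_eq_zero {X A : Type*} [AddMonoid A] (l : List X) (q : X → Bool)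
    (f : X → A)
    (h : ∀ x ∈ l, q x = false → f x = 0) : ((l.filter q).map f).sum = (l.map f).sum := by
  induction l with
  | nil => rfl
  | cons a l ih =>
    have ih := ih fun x hx => h x (List.mem_cons_of_mem _ hx)
    cases hq : q a with
    | true => simp [hq, ih]
    | false => simp [hq, ih, h a List.mem_cons_self hq]

/-- The quadric and the octics through the special points. -/
def specialForm : Option (Fin 4) → (Fin 5 → ℕ) → ZMod 29
  | none => termCoeff quadricTerms
  | some w => termCoeff (sectionTerms w)

/-- The degrees of the quadric and the octics. -/
def formDeg : Option (Fin 4) → ℕ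
  | none => 2
  | some _ => 8

theorem formDeg_le (j : Option (Fin 4)) : formDeg j ≤ 15 := by
  cases j <;> simp [formDeg]

/-- The exponent of the monomial of degree `d` in `x₁, x₂, x₃, x₄` that becomes `s ^ i u ^ j` on the
quadric surface (in the chart `s' = u' = 1`) and is not divisible by `x₁ x₄`. -/
def normalExp (d i j : ℕ) : Fin 5 → ℕ :=
  ![0, i + j - d, i - (i + j - d), j - (i + j - d), d - (i + j)]

theorem normalExp_mem_expo {d i j : ℕ} (hi : i ≤ d) (hj : j ≤ d) : normalExp d i j ∈ expo 5 d := by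
  rw [mem_expo, Fin.sum_univ_five]
  simp only [normalExp, Matrix.cons_val]
  omega

/-- Modulo `x₁ x₄ = x₂ x₃` a monomial depends only on its bidegree. -/
theorem eq_normalExp_of_quadric {A : Type*} {d : ℕ} {V : (Fin 5 → ℕ) → A}
    (hV : ∀ m ∈ expo 5 d, m 0 = 0 → V (![0, 1, 0, 0, 1] + m) = V (![0, 0, 1, 1, 0] + m)) :
    ∀ (t : ℕ) (α : Fin 5 → ℕ), α 1 = t → α ∈ expo 5 (d + 2) → α 0 = 0 →
      V α = V (normalExp (d + 2) (α 1 + α 2) (α 1 + α 3)) := by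
  intro t
  induction t with
  | zero =>
    intro α h1 hα h0
    congr 1
    rw [mem_expo, Fin.sum_univ_five] at hα
    ext j
    fin_cases j <;> simp [normalExp] <;> omega
  | succ t ih =>
    intro α h1 hα h0
    rw [mem_expo, Fin.sum_univ_five] at hα
    by_cases h4 : α 4 = 0
    · congr 1
      ext j
      fin_cases j <;> simp [normalExp] <;> omega
    · have e1 : α = ![0, 1, 0, 0, 1] + ![0, t, α 2, α 3, α 4 - 1] := by
        ext j
        fin_cases j <;> simp <;> omega
      conv_lhs => rw [e1]
      rw [hV _ (by rw [mem_expo, Fin.sum_univ_five]; simp only [Matrix.cons_val]; omega) rfl]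
      have e2 : ![0, 0, 1, 1, 0] + ![0, t, α 2, α 3, α 4 - 1] =
          ![0, t, α 2 + 1, α 3 + 1, α 4 - 1] := by
        ext j
        fin_cases j <;> simp <;> omega
      rw [e2, ih _ rfl (by rw [mem_expo, Fin.sum_univ_five]; simp only [Matrix.cons_val]; omega)
          rfl]
      simp only [Matrix.cons_val]
      congr 2 <;> omega

/-- The quadric and the octics through the special points have no common zero on the hyperplane
`x₀ = 0`. -/
theorem macaulay_specialForm_injective (v : expo 5 15 → ZMod 29)
    (hv : (macaulay 15 0 formDeg specialForm).mulVec v = 0) : v = 0 := by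
  obtain ⟨V, rfl⟩ := exists_extension v
  have h0 : ∀ α ∈ expo 5 15, α 0 ≠ 0 → V α = 0 := fun α =>
    eq_zero_of_macaulay_mulVec_eq_zero (by norm_num) hv
  have hquad : ∀ m ∈ expo 5 13, m 0 = 0 → V (![0, 1, 0, 0, 1] + m) = V (![0, 0, 1, 1, 0] + m) := by
    intro m hm _
    have h := congrFun hv (Sum.inl ⟨none, ⟨m, hm⟩⟩)
    rw [macaulay_mulVec_inl 0 formDeg_le] at h
    simp only [formDeg, specialForm] at h
    rw [sum_termCoeff_mul mem_expo_of_mem_quadricTerms (fun α => V (α + m))] at h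
    have h28 : (28 : ZMod 29) = -1 := by decide
    have h2 : V (![2, 0, 0, 0, 0] + m) = 0 := by
      refine h0 _ ?_ (by simp)
      have := add_mem_expo (n := 5) (d := 2) (α := ![2, 0, 0, 0, 0]) (by decide) hm
      exact this
    simp only [quadricTerms, List.map_cons, List.map_nil, List.sum_cons, List.sum_nil,
      Nat.cast_one, Nat.cast_ofNat, h28, h2, Pi.zero_apply] at h
    linear_combination h
  have hnormal := fun α => eq_normalExp_of_quadric hquad (α 1) α rfl
  have hU : ∀ k < 256, V (normalExp 15 (k % 16) (k / 16)) = 0 := by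
    refine eq_zero_of_sparseRowsInjective sparseRowsInjective_bihomogeneousRows (by norm_num)
      (fun k => V (normalExp 15 (k % 16) (k / 16))) ?_
    intro l hl
    simp only [bihomogeneousRows, List.mem_flatMap, List.mem_map, List.mem_range] at hl
    obtain ⟨w, -, a, ha, b, hb, rfl⟩ := hl
    have hm : normalExp 7 a b ∈ expo 5 7 := normalExp_mem_expo (by omega) (by omega)
    have h := congrFun hv (Sum.inl ⟨some w, ⟨_, hm⟩⟩)
    rw [macaulay_mulVec_inl 0 formDeg_le] at h
    simp only [formDeg, specialForm] at h
    rw [sum_termCoeff_mul (mem_expo_of_mem_sectionTerms w) (fun α => V (α + normalExp 7 a b))] at h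
    rw [bihomogeneousRow, List.map_map]
    refine Eq.trans ?_ h
    rw [← sum_map_filter_of_eq_zero _ (fun γc : (Fin 5 → ℕ) × ℕ => γc.1 0 == 0)
      (fun γc : (Fin 5 → ℕ) × ℕ => (γc.2 : ZMod 29) * V (γc.1 + normalExp 7 a b))]
    · congr 1
      refine List.map_congr_left fun γc hγc => ?_
      obtain ⟨hγ, hγ0⟩ := List.mem_filter.mp hγc
      have hγ := mem_expo_of_mem_sectionTerms w γc hγ
      have hmem := add_mem_expo hγ hm
      rw [beq_iff_eq] at hγ0
      rw [hnormal _ hmem (by simp [hγ0, normalExp])]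
      rw [mem_expo, Fin.sum_univ_five] at hγ
      simp only [Function.comp_apply, Pi.add_apply]
      have ea : γc.1 1 + normalExp 7 a b 1 + (γc.1 2 + normalExp 7 a b 2) =
          γc.1 1 + γc.1 2 + a := by
        simp [normalExp]; omega
      have eb : γc.1 1 + normalExp 7 a b 1 + (γc.1 3 + normalExp 7 a b 3) =
          γc.1 1 + γc.1 3 + b := by
        simp [normalExp]; omega
      rw [ea, eb]
      congr 3 <;> omega
    · intro γc hγc hγ0
      have hmem := add_mem_expo (mem_expo_of_mem_sectionTerms w γc hγc) hm
      rw [h0 _ hmem, mul_zero]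
      simp only [beq_eq_false_iff_ne] at hγ0
      rw [Pi.add_apply]
      omega
  ext ⟨α, hα⟩
  by_cases hα0 : α 0 = 0
  · change V α = 0
    rw [hnormal α hα hα0]
    rw [mem_expo, Fin.sum_univ_five] at hα
    have := hU (α 1 + α 2 + 16 * (α 1 + α 3)) (by omega)
    rwa [show (α 1 + α 2 + 16 * (α 1 + α 3)) % 16 = α 1 + α 2 by omega,
      show (α 1 + α 2 + 16 * (α 1 + α 3)) / 16 = α 1 + α 3 by omega] at this
  · exact h0 α hα hα0

/-! ### The leading quartics of the octics at a special point -/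

/-- The exponent of a monomial in `x₁, x₂, x₃`. -/
def middleExp (β : Fin 3 → ℕ) : Fin 5 → ℕ := ![0, β 0, β 1, β 2, 0]

theorem middleExp_mem_expo {d : ℕ} {β : Fin 3 → ℕ} (hβ : β ∈ expo 3 d) :
    middleExp β ∈ expo 5 d := by
  rw [mem_expo, Fin.sum_univ_three] at hβ
  rw [mem_expo, Fin.sum_univ_five]
  simp only [middleExp, Matrix.cons_val]
  omega

/-- A sum over the monomials in five variables whose terms are supported on `x₁, x₂, x₃`. -/
theorem sum_expo_middleExp {A : Type*} [AddCommMonoid A] (d : ℕ) (f : (Fin 5 → ℕ) → A)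
    (hf : ∀ α ∈ expo 5 d, α 0 ≠ 0 ∨ α 4 ≠ 0 → f α = 0) :
    ∑ α ∈ expo 5 d, f α = ∑ β ∈ expo 3 d, f (middleExp β) := by
  symm
  refine Finset.sum_of_injOn middleExp ?_ (fun β hβ => middleExp_mem_expo hβ) ?_ fun _ _ => rfl
  · intro β _ β' _ h
    ext j
    fin_cases j
    · exact congrFun h 1
    · exact congrFun h 2
    · exact congrFun h 3
  · intro α hα hα'
    refine hf α hα ?_
    by_contra! h
    refine hα' ⟨![α 1, α 2, α 3], ?_, ?_⟩
    · rw [mem_expo, Fin.sum_univ_five] at hα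
      simp only [Finset.mem_coe, mem_expo, Fin.sum_univ_three, Matrix.cons_val]
      omega
    · ext j
      fin_cases j <;> simp [middleExp, h.1, h.2]

/-- The Hasse derivatives of order `4` of a monomial in the directions of `x₁, x₂, x₃` at the
special point `basePt 0`. -/
def leadRow (γ : Fin 5 → ℕ) : List ℕ :=
  withValue (γ 1) fun a₁ => withValue (γ 2) fun a₂ => withValue (γ 3) fun a₃ =>
    jetRow 29 [(1, a₁), (1, a₂), (2, a₃)] 4 1

theorem leadRow_map_cast (γ : Fin 5 → ℕ) :
    (leadRow γ).map (Nat.cast : ℕ → ZMod 29) = (List.Nat.antidiagonalTuple 3 4).map fun β =>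
      jet (fun j => (basePt 0 j : ZMod 29)) γ (middleExp β) := by
  simp only [leadRow, withValue_eq, jetRow_map_cast, Nat.cast_one, one_mul]
  refine List.map_congr_left fun β _ => ?_
  simp only [jet, Fin.prod_univ_five, middleExp, basePt]
  refine (Fin.prod_univ_three _).trans ?_
  simp

/-- The coefficients of the leading quartics at `basePt 0`. -/
def leadCoeffs (w : Fin 4) : List ℕ := combineRows 29 15 leadRow (sectionTerms w)

theorem leadCoeffs_map_cast (w : Fin 4) :
    (leadCoeffs w).map (Nat.cast : ℕ → ZMod 29) = (List.Nat.antidiagonalTuple 3 4).map fun β =>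
      hasse 8 (termCoeff (sectionTerms w)) (fun j => (basePt 0 j : ZMod 29)) (middleExp β) := by
  have hlen : (List.Nat.antidiagonalTuple 3 4).length = 15 := by decide
  have := combineRows_map_cast (p := 29) leadRow (List.Nat.antidiagonalTuple 3 4)
    (fun γ β => jet (fun j => (basePt 0 j : ZMod 29)) γ (middleExp β)) leadRow_map_cast
    (sectionTerms w)
  rw [hlen] at this
  rw [leadCoeffs, this]
  refine List.map_congr_left fun β _ => ?_
  rw [hasse, sum_termCoeff_mul (mem_expo_of_mem_sectionTerms w)]

theorem sum_map_zipWith_mul {X : Type*} {p : ℕ} (key : X → ℕ) (v : ℕ → ZMod p) (B : List X)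
    (J : X → ZMod p) (l : List ℕ) (h : l.map (Nat.cast : ℕ → ZMod p) = B.map J) :
    ((List.zipWith (fun β c => (key β, c)) B l).map fun kc => (kc.2 : ZMod p) * v kc.1).sum =
      (B.map fun β => J β * v (key β)).sum := by
  induction B generalizing l with
  | nil => simp
  | cons b B ih =>
    cases l with
    | nil => simp at h
    | cons a l =>
      simp only [List.map_cons, List.cons.injEq] at h
      rw [List.zipWith_cons_cons, List.map_cons, List.sum_cons, ih l h.2, List.map_cons,
        List.sum_cons, h.1]

/-- The product of a leading quartic with `x₁ ^ a x₂ ^ b x₃ ^ (3 - a - b)`, where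
`x₁ ^ i x₂ ^ j x₃ ^ (7 - i - j)` has the index `i + 8 j`. -/
def leadingRow (w : Fin 4) (a b : ℕ) : List (ℕ × ℕ) :=
  List.zipWith (fun β c => (β 0 + a + 8 * (β 1 + b), c)) (List.Nat.antidiagonalTuple 3 4)
    (leadCoeffs w)

/-- All the multiples of degree `7` of the leading quartics by monomials, and unit vectors at the
indices that belong to no monomial. -/
def leadingRows : List (List (ℕ × ℕ)) :=
  ((List.finRange 4).flatMap fun w => (List.range 4).flatMap fun a =>
    (List.range (4 - a)).map fun b => leadingRow w a b) ++
  (List.range 8).flatMap fun i => (List.range i).map fun k => [(i + 8 * (7 - k), 1)]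

set_option maxRecDepth 100000 in
theorem sparseRowsInjective_leadingRows : sparseRowsInjective 64 leadingRows = true := by
  decide +kernel

/-- The coordinate `x₀` and the leading quartics at the point `a` of the octics with coefficients
`c w`. -/
def leadingForm {A : Type*} [CommRing A] (c : Fin 4 → (Fin 5 → ℕ) → A) (a : Fin 5 → A) :
    Option (Fin 4) → (Fin 5 → ℕ) → A
  | none => fun α => if α = Pi.single 0 1 then 1 else 0
  | some w => fun β => hasse 8 (c w) a β

/-- The degrees of the forms `leadingForm`. -/
def leadingDeg : Option (Fin 4) → ℕ
  | none => 1
  | some _ => 4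

theorem leadingDeg_le (j : Option (Fin 4)) : leadingDeg j ≤ 7 := by
  cases j <;> simp [leadingDeg]

theorem sum_single_zero_mul {A : Type*} [CommRing A] (f : (Fin 5 → ℕ) → A) :
    ∑ α ∈ expo 5 1, (if α = (Pi.single 0 1 : Fin 5 → ℕ) then (1 : A) else 0) * f α =
      f (Pi.single 0 1) := by
  rw [Finset.sum_eq_single_of_mem _ (single_mem_expo 0)]
  · simp
  · intro α _ hα
    rw [if_neg hα, zero_mul]

/-- The leading quartics at the first special point have no common zero on `x₀ = x₄ = 0`. -/
theorem macaulay_leadingForm_injective (v : expo 5 7 → ZMod 29)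
    (hv : (macaulay 7 4 leadingDeg
      (leadingForm (fun w => termCoeff (sectionTerms w)) (specialPt 0))).mulVec v = 0) : v = 0 := by
  obtain ⟨V, rfl⟩ := exists_extension v
  have hpt : specialPt 0 = fun j => (basePt 0 j : ZMod 29) := by
    rw [show (0 : Fin 14) = pointIndex (0, 0) by rfl, specialPt_pointIndex]
    ext j
    simp
  rw [hpt] at hv
  have h4 : ∀ α ∈ expo 5 7, α 4 ≠ 0 → V α = 0 := fun α =>
    eq_zero_of_macaulay_mulVec_eq_zero (by norm_num) hv
  have h0 : ∀ α ∈ expo 5 7, α 0 ≠ 0 → V α = 0 := by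
    intro α hα hα0
    have hsub : Pi.single 0 1 + (α - Pi.single 0 1) = α := by
      refine add_tsub_cancel_of_le fun j => ?_
      by_cases hj : j = 0
      · subst hj; simpa using Nat.one_le_iff_ne_zero.mpr hα0
      · simp [Pi.single_eq_of_ne hj]
    have hmem : α - Pi.single 0 1 ∈ expo 5 6 := by
      rw [mem_expo, Fin.sum_univ_five] at hα ⊢
      simp
      omega
    have h := congrFun hv (Sum.inl ⟨none, ⟨_, hmem⟩⟩)
    rw [macaulay_mulVec_inl 4 leadingDeg_le] at h
    have h' := (sum_single_zero_mul (fun β => V (β + (α - Pi.single 0 1)))).symm.trans h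
    rwa [hsub] at h'
  let U : ℕ → ZMod 29 := fun k =>
    if k % 8 + k / 8 ≤ 7 then V (middleExp ![k % 8, k / 8, 7 - (k % 8 + k / 8)]) else 0
  have hU : ∀ k < 64, U k = 0 := by
    refine eq_zero_of_sparseRowsInjective sparseRowsInjective_leadingRows (by norm_num) U ?_
    intro l hl
    simp only [leadingRows, List.mem_append, List.mem_flatMap, List.mem_map, List.mem_range] at hl
    rcases hl with ⟨w, -, a, ha, b, hb, rfl⟩ | ⟨i, hi, k, hk, rfl⟩
    · have hm : middleExp ![a, b, 3 - (a + b)] ∈ expo 5 3 := middleExp_mem_expo (by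
        rw [mem_expo, Fin.sum_univ_three]; simp only [Matrix.cons_val]; omega)
      have h := congrFun hv (Sum.inl ⟨some w, ⟨_, hm⟩⟩)
      rw [macaulay_mulVec_inl 4 leadingDeg_le] at h
      simp only [leadingDeg, leadingForm] at h
      rw [sum_expo_middleExp, sum_expo_eq_list_sum] at h
      · rw [leadingRow, sum_map_zipWith_mul (fun β : Fin 3 → ℕ => β 0 + a + 8 * (β 1 + b)) U _ _ _
          (leadCoeffs_map_cast w)]
        refine Eq.trans ?_ h
        congr 1
        refine List.map_congr_left fun β hβ => ?_
        have hβ := mem_expo_iff_mem_list.mpr hβ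
        rw [mem_expo, Fin.sum_univ_three] at hβ
        have e1 : (β 0 + a + 8 * (β 1 + b)) % 8 = β 0 + a := by omega
        have e2 : (β 0 + a + 8 * (β 1 + b)) / 8 = β 1 + b := by omega
        simp only [U]
        rw [e1, e2, if_pos (by omega)]
        congr 2
        ext j
        fin_cases j <;> simp [middleExp]
        omega
      · intro α hα hα'
        have hmem := add_mem_expo hα hm
        rcases hα' with h' | h'
        · rw [h0 _ hmem (by rw [Pi.add_apply]; omega), mul_zero]
        · rw [h4 _ hmem (by rw [Pi.add_apply]; omega), mul_zero]
    · simp only [List.map_cons, List.map_nil, List.sum_cons, List.sum_nil, U]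
      rw [if_neg (by omega), mul_zero, add_zero]
  ext ⟨α, hα⟩
  change V α = 0
  by_cases hα0 : α 0 = 0
  · by_cases hα4 : α 4 = 0
    · rw [mem_expo, Fin.sum_univ_five] at hα
      have := hU (α 1 + 8 * α 2) (by omega)
      simp only [U, show (α 1 + 8 * α 2) % 8 = α 1 by omega,
        show (α 1 + 8 * α 2) / 8 = α 2 by omega] at this
      rw [if_pos (by omega)] at this
      rw [← this]
      congr 1
      ext j
      fin_cases j <;> simp [middleExp] <;> omega
    · exact h4 α hα hα4
  · exact h0 α hα hα0

/-! ### From the special points to general points -/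

/-- The matrix `M` has a left inverse up to the factor `Δ`. -/
def LeftInvertible {A m n : Type*} [CommRing A] [Fintype m] [DecidableEq n] (M : Matrix m n A)
    (Δ : A) :
    Prop :=
  ∃ C : Matrix n m A, C * M = Δ • (1 : Matrix n n A)

/-- The matrix `M` has a right inverse up to the factor `Δ`. -/
def RightInvertible {A m n : Type*} [CommRing A] [Fintype n] [DecidableEq m] (M : Matrix m n A)
    (Δ : A) :
    Prop :=
  ∃ C : Matrix n m A, M * C = Δ • (1 : Matrix m m A)

theorem map_mul_eq_smul_one {A B : Type*} [CommRing A] [CommRing B] {m n : Type*} [Fintype n]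
    [DecidableEq m] (ψ : A →+* B) {M : Matrix m n A} {C : Matrix n m A} {Δ : A}
    (h : M * C = Δ • (1 : Matrix m m A)) : M.map ψ * C.map ψ = ψ Δ • (1 : Matrix m m B) := by
  rw [← Matrix.map_mul, h]
  ext i j
  simp [Matrix.one_apply, apply_ite ψ]

theorem LeftInvertible.map {A B : Type*} [CommRing A] [CommRing B] {m n : Type*} [Fintype m]
    [DecidableEq n] {M : Matrix m n A} {Δ : A} (h : LeftInvertible M Δ) (ψ : A →+* B) :
    LeftInvertible (M.map ψ) (ψ Δ) :=
  let ⟨C, hC⟩ := h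
  ⟨C.map ψ, map_mul_eq_smul_one ψ hC⟩

theorem RightInvertible.map {A B : Type*} [CommRing A] [CommRing B] {m n : Type*} [Fintype n]
    [DecidableEq m] {M : Matrix m n A} {Δ : A} (h : RightInvertible M Δ) (ψ : A →+* B) :
    RightInvertible (M.map ψ) (ψ Δ) :=
  let ⟨C, hC⟩ := h
  ⟨C.map ψ, map_mul_eq_smul_one ψ hC⟩

theorem macaulay_congr {n : ℕ} {J A : Type*} [CommRing A] (N : ℕ) (e : Fin n) {deg : J → ℕ}
    {g g' : J → (Fin n → ℕ) → A} (h : ∀ j, ∀ α ∈ expo n (deg j), g j α = g' j α) :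
    macaulay N e deg g = macaulay N e deg g' := by
  ext r β
  rcases r with jm | m
  · simp only [macaulay, Matrix.of_apply, Sum.elim_inl]
    exact Finset.sum_congr rfl fun α hα => by rw [h _ α hα]
  · rfl

theorem hasse_congr {A : Type*} [CommRing A] {n d : ℕ} {c c' : (Fin n → ℕ) → A}
    (h : ∀ α ∈ expo n d, c α = c' α) (a : Fin n → A) (β : Fin n → ℕ) :
    hasse d c a β = hasse d c' a β :=
  Finset.sum_congr rfl fun α hα => by rw [h α hα]

theorem map_leadingForm {A A' : Type*} [CommRing A] [CommRing A'] (f : A →+* A')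
    (c : Fin 4 → (Fin 5 → ℕ) → A) (a : Fin 5 → A) (j : Option (Fin 4)) (α : Fin 5 → ℕ) :
    f (leadingForm c a j α) = leadingForm (fun w α => f (c w α)) (fun i => f (a i)) j α := by
  cases j with
  | none => simp [leadingForm, apply_ite f]
  | some w => exact map_hasse f _ _ _ _

/-- The order of vanishing at the points, minus one, that is required of the forms. -/
def formOrder : Option (Fin 4) → ℕ
  | none => 0
  | some _ => 3

/-- The coefficients `f none` of a quadric and `f (some w)` of four octics belong to forms of
multiplicity `1` and `4` at the points `x i`. -/
def VanishAt {A : Type*} [CommRing A] (f : Option (Fin 4) → (Fin 5 → ℕ) → A)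
    (x : Fin 14 → Fin 5 → A) : Prop :=
  ∀ j i, ∀ β ∈ expo 5 (formOrder j), hasse (formDeg j) (f j) (x i) β = 0

theorem VanishAt.map {A A' : Type*} [CommRing A] [CommRing A']
    {f : Option (Fin 4) → (Fin 5 → ℕ) → A} {x : Fin 14 → Fin 5 → A} (h : VanishAt f x)
    (ψ : A →+* A') : VanishAt (fun j α => ψ (f j α)) fun i k => ψ (x i k) := by
  intro j i β hβ
  rw [← map_hasse, h j i β hβ, map_zero]

theorem vanishAt_specialForm : VanishAt specialForm specialPt := by
  intro j i β hβ
  cases j with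
  | none =>
    exact hasse_specialPt_eq_zero mem_expo_of_mem_quadricTerms expWeight_of_mem_quadricTerms
      hasVanishingJets_quadricTerms i hβ
  | some w =>
    exact hasse_specialPt_eq_zero (mem_expo_of_mem_sectionTerms w)
      (expWeight_of_mem_sectionTerms w) (hasVanishingJets_sectionTerms w) i hβ

/-- The coordinate ring of the universal fourteen-tuple of vectors. -/
abbrev CoordRing : Type := MvPolynomial (Fin 14 × Fin 5) ℤ

/-- The universal fourteen-tuple of vectors. -/
noncomputable def universalPt (i : Fin 14) (j : Fin 5) : CoordRing := MvPolynomial.X (i, j)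

/-- The specialization of the universal points to the given ones. -/
noncomputable def specialize {A : Type*} [CommRing A] (x : Fin 14 → Fin 5 → A) : CoordRing →+* A :=
  MvPolynomial.eval₂Hom (Int.castRingHom A) fun ij => x ij.1 ij.2

theorem specialize_universalPt {A : Type*} [CommRing A] (x : Fin 14 → Fin 5 → A) (i : Fin 14)
    (j : Fin 5) : specialize x (universalPt i j) = x i j := by
  simp [specialize, universalPt]

theorem specialize_surjective (x : Fin 14 → Fin 5 → ZMod 29) : Function.Surjective (specialize x) :=
  fun a => ⟨(a.val : ℤ), by simp⟩

theorem specialize_rename {A : Type*} [CommRing A] (x : Fin 14 → Fin 5 → A)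
    (σ : Equiv.Perm (Fin 14)) (Δ : CoordRing) :
    specialize x (MvPolynomial.rename (Prod.map σ id) Δ) = specialize (fun i => x (σ i)) Δ := by
  simp only [specialize, MvPolynomial.coe_eval₂Hom, MvPolynomial.eval₂_rename]
  rfl

theorem ne_zero_of_map_eq_one {A B : Type*} [CommRing A] [CommRing B] [Nontrivial B] {φ : A →+* B}
    {Δ : A} (h : φ Δ = 1) : Δ ≠ 0 := by
  rintro rfl
  simp at h

/-- If the multiplicity conditions at the special points are independent, then so are those at the
universal points. -/
theorem exists_right_inverse_universalPt {d m : ℕ} (h : weightBlocksIndependent d m = true)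
    (hm : 29 + 2 * (List.Nat.antidiagonalTuple 5 m).length * (29 * 29) < 2 ^ 20) :
    ∃ Δ : CoordRing, specialize specialPt Δ = 1 ∧
      RightInvertible (condMatrix d m universalPt) Δ := by
  obtain ⟨Δ, C, hΔ, hC⟩ := exists_right_inverse_of_specialization
    (specialize_surjective specialPt) (condMatrix d m universalPt) fun v hv =>
      vecMul_condMatrix_specialPt_injective h hm v (by
        simp only [condMatrix_map, specialize_universalPt] at hv
        exact hv)
  exact ⟨Δ, hΔ, C, hC⟩

/-- In this case the forms with these multiplicities at the special points are specializations of
forms with these multiplicities at the universal points. -/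
theorem exists_lift_of_weightBlocksIndependent {d m : ℕ} (h : weightBlocksIndependent d m = true)
    (hm : 29 + 2 * (List.Nat.antidiagonalTuple 5 m).length * (29 * 29) < 2 ^ 20)
    {c : (Fin 5 → ℕ) → ZMod 29} (hc : ∀ i, ∀ β ∈ expo 5 m, hasse d c (specialPt i) β = 0) :
    ∃ f : (Fin 5 → ℕ) → CoordRing, (∀ i, ∀ β ∈ expo 5 m, hasse d f (universalPt i) β = 0) ∧
      ∀ α ∈ expo 5 d, specialize specialPt (f α) = c α := by
  obtain ⟨Δ, hΔ, C, hC⟩ := exists_right_inverse_universalPt h hm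
  obtain ⟨f, hf, hf'⟩ := exists_lift_of_right_inverse (specialize_surjective specialPt) hΔ hC
    (f := fun α => c α) (by
      simp only [condMatrix_map, specialize_universalPt]
      ext r
      rw [condMatrix_mulVec]
      exact hc r.1 r.2 r.2.2)
  obtain ⟨V, rfl⟩ := exists_extension f
  refine ⟨V, fun i β hβ => ?_, fun α hα => hf' ⟨α, hα⟩⟩
  have := congrFun hf (i, ⟨β, hβ⟩)
  rwa [condMatrix_mulVec] at this

theorem length_antidiagonalTuple_five_three : (List.Nat.antidiagonalTuple 5 3).length = 35 := by
  decide +kernel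

theorem exists_lift_specialForm (j : Option (Fin 4)) : ∃ f : (Fin 5 → ℕ) → CoordRing,
    (∀ i, ∀ β ∈ expo 5 (formOrder j), hasse (formDeg j) f (universalPt i) β = 0) ∧
    ∀ α ∈ expo 5 (formDeg j), specialize specialPt (f α) = specialForm j α := by
  cases j with
  | none =>
    refine exists_lift_of_weightBlocksIndependent weightBlocksIndependent_two_zero ?_
      (vanishAt_specialForm none)
    rw [show (List.Nat.antidiagonalTuple 5 0).length = 1 by decide +kernel]
    norm_num
  | some w =>
    refine exists_lift_of_weightBlocksIndependent weightBlocksIndependent_eight_three ?_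
      (vanishAt_specialForm (some w))
    rw [length_antidiagonalTuple_five_three]
    norm_num

/-- The quadric and the octics through the universal points, with the two finiteness certificates.
-/
theorem exists_universal_forms : ∃ f : Option (Fin 4) → (Fin 5 → ℕ) → CoordRing,
    VanishAt f universalPt ∧
    (∃ Δ : CoordRing, Δ ≠ 0 ∧ LeftInvertible (macaulay 15 0 formDeg f) Δ) ∧
    ∃ Δ : CoordRing, Δ ≠ 0 ∧
      LeftInvertible (macaulay 7 4 leadingDeg
        (leadingForm (fun w => f (some w)) (universalPt 0))) Δ := by
  choose f hf hf' using exists_lift_specialForm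
  refine ⟨f, hf, ?_, ?_⟩
  · obtain ⟨Δ, C, hΔ, hC⟩ := exists_left_inverse_of_specialization
      (specialize_surjective specialPt) (macaulay 15 0 formDeg f) fun v hv => by
        rw [macaulay_map, macaulay_congr 15 0 hf'] at hv
        exact macaulay_specialForm_injective v hv
    exact ⟨Δ, ne_zero_of_map_eq_one hΔ, C, hC⟩
  · obtain ⟨Δ, C, hΔ, hC⟩ := exists_left_inverse_of_specialization
      (specialize_surjective specialPt)
      (macaulay 7 4 leadingDeg (leadingForm (fun w => f (some w)) (universalPt 0))) fun v hv => by
        rw [macaulay_map, macaulay_congr 7 4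
          (g' := leadingForm (fun w => termCoeff (sectionTerms w)) (specialPt 0)) ?_] at hv
        · exact macaulay_leadingForm_injective v hv
        intro j α _
        rw [map_leadingForm]
        simp only [specialize_universalPt]
        cases j with
        | none => rfl
        | some w => exact hasse_congr (hf' (some w)) _ _
    exact ⟨Δ, ne_zero_of_map_eq_one hΔ, C, hC⟩

/-- What is needed of fourteen points: the conditions imposed on octics by fourfold points are
independent, the octics and quadrics have finitely many common zeros in projective space, and their
leading forms at each of the points have finitely many common zeros in the projectivized tangent
space, which is identified with the hyperplane `x₀ = 0`. -/
structure GeneralPosition {K : Type*} [Field K] (x : Fin 14 → Fin 5 → K) : Prop where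
  coord_ne_zero : ∀ i, x i 0 ≠ 0
  independent : ∃ Δ : K, Δ ≠ 0 ∧ RightInvertible (condMatrix 8 3 x) Δ
  zeros : ∃ f, VanishAt f x ∧
    (∀ z : Fin 5 → K, z 0 = 0 → (∀ j, ∑ α ∈ expo 5 (formDeg j), f j α * mpow z α = 0) → z = 0) ∧
    {z : Fin 5 → K | z 0 = 1 ∧ ∀ j, ∑ α ∈ expo 5 (formDeg j), f j α * mpow z α = 0}.Finite
  leading_zeros : ∀ i, ∃ f, VanishAt f x ∧
    (∀ z : Fin 5 → K, z 0 = 0 → z 4 = 0 →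
      (∀ w, ∑ β ∈ expo 5 4, hasse 8 (f (some w)) (x i) β * mpow z β = 0) → z = 0) ∧
    {z : Fin 5 → K | z 0 = 0 ∧ z 4 = 1 ∧
      ∀ w, ∑ β ∈ expo 5 4, hasse 8 (f (some w)) (x i) β * mpow z β = 0}.Finite

theorem forall_leadingForm_iff {K : Type*} [Field K] (c : Fin 4 → (Fin 5 → ℕ) → K)
    (a z : Fin 5 → K) :
    (∀ j, ∑ α ∈ expo 5 (leadingDeg j), leadingForm c a j α * mpow z α = 0) ↔
      z 0 = 0 ∧ ∀ w, ∑ β ∈ expo 5 4, hasse 8 (c w) a β * mpow z β = 0 := by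
  rw [Option.forall]
  refine and_congr ?_ Iff.rfl
  have := sum_single_zero_mul (fun α => mpow z α)
  rw [mpow_single] at this
  rw [← this]
  rfl

/-- Points at which none of finitely many nonzero polynomials vanishes are in general position. -/
theorem exists_forall_generalPosition (K : Type*) [Field K] :
    ∃ Δ : CoordRing, Δ ≠ 0 ∧ ∀ x : Fin 14 → Fin 5 → K, specialize x Δ ≠ 0 → GeneralPosition x := by
  obtain ⟨Δ₁, hΔ₁, hC₁⟩ := exists_right_inverse_universalPt
    weightBlocksIndependent_eight_three (by
      rw [length_antidiagonalTuple_five_three]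
      norm_num)
  obtain ⟨f, hf, ⟨Δ₂, hΔ₂, hC₂⟩, ⟨Δ₃, hΔ₃, hC₃⟩⟩ := exists_universal_forms
  refine ⟨(∏ i, universalPt i 0) * Δ₁ * Δ₂ *
    ∏ i, MvPolynomial.rename (Prod.map (Equiv.swap 0 i) id) Δ₃, ?_, fun x hx => ?_⟩
  · refine mul_ne_zero (mul_ne_zero (mul_ne_zero (Finset.prod_ne_zero_iff.mpr fun i _ =>
      MvPolynomial.X_ne_zero _) (ne_zero_of_map_eq_one hΔ₁)) hΔ₂)
      (Finset.prod_ne_zero_iff.mpr fun i _ => ?_)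
    rw [Ne, map_eq_zero_iff _ (MvPolynomial.rename_injective _
      ((Equiv.swap 0 i).injective.prodMap Function.injective_id))]
    exact hΔ₃
  · simp only [map_mul, map_prod, mul_ne_zero_iff, Finset.prod_ne_zero_iff, Finset.mem_univ,
      true_imp_iff, specialize_rename, specialize_universalPt] at hx
    obtain ⟨⟨⟨hx0, hx1⟩, hx2⟩, hx3⟩ := hx
    refine ⟨hx0, ⟨_, hx1, ?_⟩, ⟨fun j α => specialize x (f j α), ?_, ?_⟩, fun i =>
      ⟨fun j α => specialize (fun k => x (Equiv.swap 0 i k)) (f j α), ?_, ?_⟩⟩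
    · have := hC₁.map (specialize x)
      simpa only [condMatrix_map, specialize_universalPt] using this
    · simpa only [specialize_universalPt] using hf.map (specialize x)
    · obtain ⟨C, h⟩ := hC₂.map (specialize x)
      rw [macaulay_map] at h
      exact ⟨fun z hz0 hz => eq_zero_of_macaulay (by norm_num) formDeg_le hx2 h hz0 hz,
        finite_of_macaulay (by norm_num) formDeg_le hx2 h⟩
    · have h := hf.map (specialize fun k => x (Equiv.swap 0 i k))
      simp only [specialize_universalPt] at h
      intro j k β hβ
      have := h j (Equiv.swap 0 i k) β hβ
      simpa only [Equiv.swap_apply_self] using this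
    · obtain ⟨C, h⟩ := hC₃.map (specialize fun k => x (Equiv.swap 0 i k))
      rw [macaulay_map, macaulay_congr 7 4 fun j α _ => map_leadingForm _ _ _ j α] at h
      simp only [specialize_universalPt, Equiv.swap_apply_left] at h
      refine ⟨fun z hz0 hz4 hz => eq_zero_of_macaulay (by norm_num) leadingDeg_le (hx3 i) h hz4
        ((forall_leadingForm_iff _ _ _).mpr ⟨hz0, hz⟩), ?_⟩
      refine (finite_of_macaulay (by norm_num) leadingDeg_le (hx3 i) h).subset ?_
      rintro z ⟨hz0, hz4, hz⟩
      exact ⟨hz4, (forall_leadingForm_iff _ _ _).mpr ⟨hz0, hz⟩⟩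

/-! ### Dimensions of linear systems -/

section

variable {K : Type*} [Field K] {n r : ℕ}

theorem forall_hasse_rep_iff {d m : ℕ} (c : (Fin n → ℕ) → K) (a : Fin n → K) (ha : a ≠ 0) :
    (∀ β ∈ expo n m, hasse d c (Projectivization.mk K a ha).rep β = 0) ↔
      ∀ β ∈ expo n m, hasse d c a β = 0 := by
  obtain ⟨s, hs⟩ := Projectivization.exists_smul_eq_mk_rep K a ha
  refine forall₂_congr fun β hβ => ?_
  rw [← hs, Units.smul_def, hasse_smul _ _ _ _ hβ, mul_eq_zero]
  exact or_iff_right (pow_ne_zero _ s.ne_zero)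

theorem toForm_mem_globalSections_iff [CharZero K] {d m : ℕ} (hmd : m ≤ d)
    (x : Fin r → Fin (n + 1) → K) (hx : ∀ i, x i ≠ 0) (c : (Fin (n + 1) → ℕ) → K) :
    toForm d c ∈ globalSections (fun i => Projectivization.mk K (x i) (hx i))
      ⟨d, fun _ => m + 1⟩ ↔ ∀ i, ∀ β ∈ expo (n + 1) m, hasse d c (x i) β = 0 := by
  refine (and_iff_right (toForm_isHomogeneous d c)).trans (forall_congr' fun i => ?_)
  exact (coeff_lineRestriction_eq_zero_iff hmd c _).trans (forall_hasse_rep_iff c _ _)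

/-- The linear map that takes a vector of coefficients to the form of degree `d`. -/
noncomputable def formOfCoeffs (n d : ℕ) : (expo n d → K) →ₗ[K] MvPolynomial (Fin n) K :=
  ∑ α : expo n d, (MvPolynomial.monomial (Finsupp.equivFunOnFinite.symm (α : Fin n → ℕ))).comp
    (LinearMap.proj α)

theorem formOfCoeffs_apply (d : ℕ) (c : (Fin n → ℕ) → K) :
    formOfCoeffs n d (fun α => c α) = toForm d c := by
  rw [formOfCoeffs, LinearMap.sum_apply, toForm, ← Finset.sum_coe_sort (expo n d)]
  rfl

theorem formOfCoeffs_injective (d : ℕ) : Function.Injective (formOfCoeffs (K := K) n d) := by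
  refine (injective_iff_map_eq_zero _).mpr fun v hv => ?_
  obtain ⟨c, rfl⟩ := exists_extension v
  rw [formOfCoeffs_apply] at hv
  ext α
  change c α = 0
  rw [← coeff_toForm d c α.2, hv, MvPolynomial.coeff_zero]

theorem globalSections_eq_map [CharZero K] {d m : ℕ} (hmd : m ≤ d)
    (x : Fin r → Fin (n + 1) → K) (hx : ∀ i, x i ≠ 0) :
    globalSections (fun i => Projectivization.mk K (x i) (hx i)) ⟨d, fun _ => m + 1⟩ =
      (LinearMap.ker (condMatrix d m x).mulVecLin).map (formOfCoeffs (n + 1) d) := by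
  have hker : ∀ c : (Fin (n + 1) → ℕ) → K,
      (fun α : expo (n + 1) d => c α) ∈ LinearMap.ker (condMatrix d m x).mulVecLin ↔
        ∀ i, ∀ β ∈ expo (n + 1) m, hasse d c (x i) β = 0 := by
    intro c
    rw [LinearMap.mem_ker, Matrix.mulVecLin_apply, funext_iff, Prod.forall]
    refine forall_congr' fun i => ?_
    rw [Subtype.forall]
    refine forall₂_congr fun β hβ => ?_
    rw [condMatrix_mulVec]
    rfl
  ext F
  rw [Submodule.mem_map]
  constructor
  · intro hF
    have hF' := eq_toForm hF.1
    refine ⟨_, (hker _).mpr ?_, (formOfCoeffs_apply d _).trans hF'.symm⟩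
    rw [hF'] at hF
    exact (toForm_mem_globalSections_iff hmd x hx _).mp hF
  · rintro ⟨v, hv, rfl⟩
    obtain ⟨c, rfl⟩ := exists_extension v
    rw [formOfCoeffs_apply]
    exact (toForm_mem_globalSections_iff hmd x hx _).mpr ((hker c).mp hv)

/-- If the conditions are independent, then the dimension of the space of sections is the number of
monomials minus the number of conditions. -/
theorem finrank_globalSections_add [CharZero K] {d m : ℕ} (hmd : m ≤ d)
    (x : Fin r → Fin (n + 1) → K) (hx : ∀ i, x i ≠ 0) {Δ : K} (hΔ : Δ ≠ 0)
    (h : RightInvertible (condMatrix d m x) Δ) :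
    Module.finrank K (globalSections (fun i => Projectivization.mk K (x i) (hx i))
      ⟨d, fun _ => m + 1⟩) + r * (expo (n + 1) m).card = (expo (n + 1) d).card := by
  obtain ⟨C, hC⟩ := h
  have hsurj : LinearMap.range (condMatrix d m x).mulVecLin = ⊤ := by
    refine LinearMap.range_eq_top.mpr fun v => ⟨C.mulVec (Δ⁻¹ • v), ?_⟩
    rw [Matrix.mulVecLin_apply, Matrix.mulVec_mulVec, hC, Matrix.smul_mulVec, Matrix.one_mulVec,
      smul_smul, mul_inv_cancel₀ hΔ, one_smul]
  have h1 := LinearMap.finrank_range_add_finrank_ker (condMatrix d m x).mulVecLin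
  rw [hsurj, finrank_top, Module.finrank_fintype_fun_eq_card, Module.finrank_fintype_fun_eq_card,
    Fintype.card_prod, Fintype.card_fin, Fintype.card_coe, Fintype.card_coe] at h1
  rw [globalSections_eq_map hmd x hx, ← h1, add_comm,
    ← LinearEquiv.finrank_eq (Submodule.equivMapOfInjective _ (formOfCoeffs_injective d) _)]

theorem finite_globalSections [CharZero K] {d m : ℕ} (hmd : m ≤ d)
    (x : Fin r → Fin (n + 1) → K) (hx : ∀ i, x i ≠ 0) :
    Module.Finite K (globalSections (fun i => Projectivization.mk K (x i) (hx i))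
      ⟨d, fun _ => m + 1⟩) := by
  rw [globalSections_eq_map hmd x hx]
  infer_instance

/-- If there are fewer conditions than monomials, then there are sections. -/
theorem exists_ne_zero_mem_globalSections [CharZero K] {d m : ℕ} (hmd : m ≤ d)
    (x : Fin r → Fin (n + 1) → K) (hx : ∀ i, x i ≠ 0)
    (h : r * (expo (n + 1) m).card < (expo (n + 1) d).card) :
    ∃ F ∈ globalSections (fun i => Projectivization.mk K (x i) (hx i)) ⟨d, fun _ => m + 1⟩,
      F ≠ 0 := by
  rw [globalSections_eq_map hmd x hx]
  refine Submodule.exists_mem_ne_zero_of_ne_bot ?_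
  rw [Ne, (Submodule.map_injective_of_injective (formOfCoeffs_injective d)).eq_iff'
    (Submodule.map_bot _)]
  refine LinearMap.ker_ne_bot_of_finrank_lt ?_
  rwa [Module.finrank_fintype_fun_eq_card, Module.finrank_fintype_fun_eq_card,
    Fintype.card_prod, Fintype.card_fin, Fintype.card_coe, Fintype.card_coe]

theorem pow_mem_globalSections (p : Fin r → ProjSpace K n) {D : DivisorClass r}
    {F : MvPolynomial (Fin (n + 1)) K} (hF : F ∈ globalSections p D) (k : ℕ) :
    F ^ k ∈ globalSections p (k • D) := by
  refine ⟨?_, fun i v => ?_⟩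
  · have := hF.1.pow k
    rwa [mul_comm] at this
  · have h := Polynomial.X_pow_dvd_iff.mpr (hF.2 i v)
    have h2 := pow_dvd_pow_of_dvd h k
    rw [← pow_mul, mul_comm, lineRestriction, ← map_pow] at h2
    exact Polynomial.X_pow_dvd_iff.mp h2

theorem one_le_finrank_of_mem_ne_zero {M : Type*} [AddCommGroup M] [Module K M] (S : Submodule K M)
    [Module.Finite K S] {F : M} (hF : F ∈ S) (h0 : F ≠ 0) : 1 ≤ Module.finrank K S := by
  have : Nontrivial S := ⟨⟨⟨F, hF⟩, 0, fun h => h0 (congrArg Subtype.val h)⟩⟩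
  exact Module.finrank_pos

end

theorem four_smul_quadricClass : 4 • quadricClass = ⟨8, fun _ => 3 + 1⟩ := rfl

theorem two_smul_quadricClass : 2 • quadricClass = ⟨4, fun _ => 1 + 1⟩ := rfl

theorem card_expo_five : (expo 5 0).card = 1 ∧ (expo 5 2).card = 15 ∧ (expo 5 3).card = 35 ∧
    (expo 5 8).card = 495 := by
  decide +kernel

section

variable {K : Type*} [Field K] [CharZero K] {x : Fin 14 → Fin 5 → K}

theorem dimLinearSystem_four_smul (hx : ∀ i, x i ≠ 0) (h : GeneralPosition x) :
    dimLinearSystem (fun i => Projectivization.mk K (x i) (hx i)) (4 • quadricClass) = 4 := by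
  obtain ⟨Δ, hΔ, hC⟩ := h.independent
  have := finrank_globalSections_add (by norm_num) x hx hΔ hC
  rw [card_expo_five.2.2.1, card_expo_five.2.2.2] at this
  rw [dimLinearSystem, four_smul_quadricClass]
  omega

theorem expectedDim_four_smul : expectedDim 4 (4 • quadricClass) = 4 := by
  rw [expectedDim, virtualDim, four_smul_quadricClass]
  simp [Nat.choose]

theorem expectedDim_two_smul : expectedDim 4 (2 • quadricClass) = -1 := by
  rw [expectedDim, virtualDim, two_smul_quadricClass]
  simp [Nat.choose]

/-- There is a quadric through fourteen points, and its square is an unexpected member of `|2D|`. -/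
theorem isSpecial_two_smul (hx : ∀ i, x i ≠ 0) :
    IsSpecial (fun i => Projectivization.mk K (x i) (hx i)) (2 • quadricClass) := by
  obtain ⟨Q, hQ, hQ0⟩ := exists_ne_zero_mem_globalSections (d := 2) (m := 0) (by norm_num) x hx (by
    rw [card_expo_five.1, card_expo_five.2.1]
    norm_num)
  have hQ2 : Q ^ 2 ∈ globalSections (fun i => Projectivization.mk K (x i) (hx i))
    (2 • quadricClass) := pow_mem_globalSections _ hQ 2
  have : Module.Finite K (globalSections (fun i => Projectivization.mk K (x i) (hx i))
    (2 • quadricClass)) := finite_globalSections (d := 4) (by norm_num) x hx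
  have h1 := one_le_finrank_of_mem_ne_zero _ hQ2 (pow_ne_zero 2 hQ0)
  rw [IsSpecial, expectedDim_two_smul, dimLinearSystem]
  omega

end

/-! ### Finite subsets of the blow-up -/

section

variable {K : Type*} [Field K] {V : Type*} [AddCommGroup V] [Module K V]

theorem eq_of_mem_submodule {v : V} (hv : v ≠ 0) {ℓ ℓ' : ℙ K V} (h : v ∈ ℓ.submodule)
    (h' : v ∈ ℓ'.submodule) : ℓ = ℓ' := by
  have key : ∀ {ℓ : ℙ K V}, v ∈ ℓ.submodule → ℓ = Projectivization.mk K v hv := by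
    intro ℓ h
    rw [Projectivization.submodule_eq, Submodule.mem_span_singleton] at h
    obtain ⟨s, rfl⟩ := h
    exact ℓ.mk_rep.symm.trans
      ((Projectivization.mk_eq_mk_iff' K _ _ hv ℓ.rep_nonzero).mpr ⟨s, rfl⟩).symm
  rw [key h, key h']

theorem rep_mem_submodule (ℓ : ℙ K V) : ℓ.rep ∈ ℓ.submodule := by
  rw [Projectivization.submodule_eq]
  exact Submodule.mem_span_singleton_self _

theorem finite_setOf_mem_submodule {S : Set V} (hS : S.Finite) :
    {ℓ : ℙ K V | ∃ s ∈ S, s ≠ 0 ∧ s ∈ ℓ.submodule}.Finite := by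
  refine (hS.biUnion (t := fun s => {ℓ : ℙ K V | s ≠ 0 ∧ s ∈ ℓ.submodule}) fun s _ => ?_).subset ?_
  · exact Set.Subsingleton.finite fun ℓ hℓ ℓ' hℓ' => eq_of_mem_submodule hℓ.1 hℓ.2 hℓ'.2
  · rintro ℓ ⟨s, hs, h⟩
    exact Set.mem_biUnion hs h

theorem exists_linearMap_separating {ℓ ℓ' : ℙ K V} (h : ℓ ≠ ℓ') :
    ∃ f : V →ₗ[K] K, f ℓ.rep ≠ 0 ∧ ∀ v ∈ ℓ'.submodule, f v = 0 := by
  obtain ⟨f, hf, hf'⟩ := Submodule.exists_le_ker_of_notMem (p := ℓ'.submodule) (v := ℓ.rep)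
    fun hmem => h (eq_of_mem_submodule ℓ.rep_nonzero (rep_mem_submodule ℓ) hmem)
  exact ⟨f, hf, fun v hv => hf' hv⟩

end

section

variable {K : Type*} [Field K] {n r : ℕ} {p : Fin r → ProjSpace K n}

theorem BlowUp.ext_of_eq {z z' : BlowUp p} (h : z.pt = z'.pt) (h' : z.dir = z'.dir) : z = z' := by
  cases z
  cases z'
  congr

theorem sum_map_single_mul (f : (Fin (n + 1) → K) →ₗ[K] K) (a : Fin (n + 1) → K) :
    ∑ j, f (Pi.single j 1) * a j = f a := by
  conv_rhs => rw [pi_eq_sum_univ' a, map_sum]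
  refine Finset.sum_congr rfl fun j _ => ?_
  rw [map_smul, smul_eq_mul, mul_comm]

theorem BlowUp.exists_isCoord (z : BlowUp p) : ∃ y : Fin r → Fin (n + 1) → K,
    z.IsCoord z.pt.rep y ∧ ∀ i, (p i).submodule.mkQ (y i) = (z.dir i).rep := by
  choose y hy using fun i => Submodule.mkQ_surjective (p i).submodule (z.dir i).rep
  refine ⟨y, ⟨⟨z.pt.rep_nonzero, rep_mem_submodule _⟩, fun i => ?_⟩, hy⟩
  rw [hy]
  exact ⟨(z.dir i).rep_nonzero, rep_mem_submodule _⟩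

/-- Points of the blow-up are separated by the coordinates on the factors of the product. -/
instance BlowUp.t1Space : T1Space (BlowUp p) := by
  refine t1Space_iff_exists_open.mpr fun z z' hzz' => ?_
  obtain ⟨y, hy, hy'⟩ := z.exists_isCoord
  by_cases hpt : z.pt = z'.pt
  · have hdir : z.dir ≠ z'.dir := fun h => hzz' (BlowUp.ext_of_eq hpt h)
    obtain ⟨i, hi⟩ := Function.ne_iff.mp hdir
    obtain ⟨f, hf, hf'⟩ := exists_linearMap_separating hi
    refine ⟨_, TopologicalSpace.isOpen_generateFrom_of_mem ⟨∑ j, MvPolynomial.C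
      (f ((p i).submodule.mkQ (Pi.single j 1))) * MvPolynomial.X (Sum.inr (i, j)), rfl⟩,
      ⟨_, y, hy, ?_⟩, ?_⟩
    · simp only [map_sum, map_mul, MvPolynomial.eval_C, MvPolynomial.eval_X, Sum.elim_inr]
      have := sum_map_single_mul (f ∘ₗ (p i).submodule.mkQ) (y i)
      simp only [LinearMap.comp_apply, hy'] at this
      rwa [this]
    · rintro ⟨a', y', h', hne⟩
      refine hne ?_
      simp only [map_sum, map_mul, MvPolynomial.eval_C, MvPolynomial.eval_X, Sum.elim_inr]
      exact (sum_map_single_mul (f ∘ₗ (p i).submodule.mkQ) (y' i)).trans (hf' _ (h'.2 i).2)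
  · obtain ⟨f, hf, hf'⟩ := exists_linearMap_separating hpt
    refine ⟨_, TopologicalSpace.isOpen_generateFrom_of_mem ⟨∑ j, MvPolynomial.C
      (f (Pi.single j 1)) * MvPolynomial.X (Sum.inl j), rfl⟩, ⟨_, y, hy, ?_⟩, ?_⟩
    · simp only [map_sum, map_mul, MvPolynomial.eval_C, MvPolynomial.eval_X, Sum.elim_inl]
      rwa [sum_map_single_mul]
    · rintro ⟨a', y', h', hne⟩
      refine hne ?_
      simp only [map_sum, map_mul, MvPolynomial.eval_C, MvPolynomial.eval_X, Sum.elim_inl]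
      rw [sum_map_single_mul]
      exact hf' _ h'.1.2

theorem topologicalKrullDim_le_zero_of_finite {X : Type*} [TopologicalSpace X] [T1Space X]
    {S : Set X} (hS : S.Finite) : topologicalKrullDim S ≤ 0 := by
  have := hS.to_subtype
  exact topologicalKrullDim_zero_of_discreteTopology S

/-- A set of points of the blow-up is finite if its image in `ℙⁿ` is finite and it meets each
exceptional divisor in a finite set: the lines `ℓᵢ` other than tangent directions are determined by
the image. -/
theorem finite_of_finite_pt_of_finite_dir {B : Set (BlowUp p)} (hpt : (BlowUp.pt '' B).Finite)
    (hdir : ∀ i, {ℓ | ∃ z ∈ B, z.pt = p i ∧ z.dir i = ℓ}.Finite) : B.Finite := by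
  refine Set.Finite.of_finite_fibers BlowUp.pt hpt fun q _ => ?_
  have hT : ∀ i, {ℓ | ∃ z ∈ B, z.pt = q ∧ z.dir i = ℓ}.Finite := by
    intro i
    by_cases hq : q = p i
    · rw [hq]
      exact hdir i
    · refine (finite_setOf_mem_submodule (Set.finite_singleton ((p i).submodule.mkQ q.rep))).subset
        ?_
      rintro _ ⟨z, -, rfl, rfl⟩
      refine ⟨_, rfl, fun h0 => hq ?_, z.incident i (Submodule.mem_map_of_mem
          (rep_mem_submodule _))⟩
      rw [Submodule.mkQ_apply, Submodule.Quotient.mk_eq_zero] at h0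
      exact eq_of_mem_submodule z.pt.rep_nonzero (rep_mem_submodule _) h0
  refine Set.Finite.of_injOn (f := BlowUp.dir) (fun z hz => ?_) (fun z hz z' hz' h => ?_)
    (Set.Finite.pi' hT)
  · exact fun i => ⟨z, hz.1, hz.2, rfl⟩
  · exact BlowUp.ext_of_eq (hz.2.trans hz'.2.symm) h

end

/-! ### The base locus -/

theorem mem_divisorSupport_of_mem_baseLocus {K : Type*} [Field K] {n r : ℕ}
    {p : Fin r → ProjSpace K n}
    {D : DivisorClass r} {z : BlowUp p} (hz : z ∈ baseLocus p D) {F : MvPolynomial (Fin (n + 1)) K}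
    (hF : F ∈ globalSections p D) : z ∈ divisorSupport p D F := by
  by_cases h0 : F = 0
  · simp [divisorSupport, lineRestriction, h0]
  · exact Set.mem_iInter₂.mp hz F ⟨hF, h0⟩

theorem sum_smul_mpow {K : Type*} [Field K] {n d : ℕ} (c : (Fin n → ℕ) → K) (s : K)
    (z : Fin n → K) :
    ∑ α ∈ expo n d, c α * mpow (s • z) α = s ^ d * ∑ α ∈ expo n d, c α * mpow z α := by
  rw [Finset.mul_sum]
  refine Finset.sum_congr rfl fun α hα => ?_
  rw [← jet_zero_right, ← jet_zero_right, jet_smul s z hα (m := 0) (by simp [mem_expo]),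
      Nat.sub_zero]
  ring

section

variable {K : Type*} [Field K] [CharZero K] {x : Fin 14 → Fin 5 → K} (hx : ∀ i, x i ≠ 0)

theorem toForm_octic_mem_globalSections {f : Option (Fin 4) → (Fin 5 → ℕ) → K} (hf : VanishAt f x)
    (w : Fin 4) : toForm 8 (f (some w)) ∈
      globalSections (fun i => Projectivization.mk K (x i) (hx i)) (4 • quadricClass) :=
  (toForm_mem_globalSections_iff (d := 8) (m := 3) (by norm_num) x hx _).mpr (hf (some w))

theorem toForm_quadric_pow_mem_globalSections {f : Option (Fin 4) → (Fin 5 → ℕ) → K}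
    (hf : VanishAt f x) : toForm 2 (f none) ^ 4 ∈
      globalSections (fun i => Projectivization.mk K (x i) (hx i)) (4 • quadricClass) :=
  pow_mem_globalSections _
    ((toForm_mem_globalSections_iff (d := 2) (m := 0) (by norm_num) x hx _).mpr (hf none)) 4

/-- Away from the exceptional divisors, the base locus lies over the common zeros of the quadric and
the octics. -/
theorem finite_pt_image_baseLocus (h : GeneralPosition x) :
    (BlowUp.pt '' baseLocus (fun i => Projectivization.mk K (x i) (hx i))
      (4 • quadricClass)).Finite := by
  obtain ⟨f, hf, h0, hfin⟩ := h.zeros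
  refine ((finite_setOf_mem_submodule (K := K) hfin).union
    (Set.finite_range fun i => Projectivization.mk K (x i) (hx i))).subset ?_
  rintro _ ⟨z, hz, rfl⟩
  by_cases hp : ∀ i, z.pt ≠ Projectivization.mk K (x i) (hx i)
  · refine Or.inl ?_
    have hzero : ∀ j, ∑ α ∈ expo 5 (formDeg j), f j α * mpow z.pt.rep α = 0 := by
      intro j
      rw [← eval_toForm]
      cases j with
      | none =>
        have := (mem_divisorSupport_of_mem_baseLocus hz
          (toForm_quadric_pow_mem_globalSections hx hf)).1 hp
        rw [map_pow] at this
        exact eq_zero_of_pow_eq_zero this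
      | some w =>
        exact (mem_divisorSupport_of_mem_baseLocus hz
          (toForm_octic_mem_globalSections hx hf w)).1 hp
    have hne : z.pt.rep 0 ≠ 0 := fun h' => z.pt.rep_nonzero (h0 _ h' hzero)
    refine ⟨(z.pt.rep 0)⁻¹ • z.pt.rep, ⟨?_, fun j => ?_⟩, ?_, ?_⟩
    · simp [hne]
    · rw [sum_smul_mpow, hzero, mul_zero]
    · exact smul_ne_zero (inv_ne_zero hne) z.pt.rep_nonzero
    · exact Submodule.smul_mem _ _ (rep_mem_submodule _)
  · push Not at hp
    obtain ⟨i, hi⟩ := hp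
    exact Or.inr ⟨i, hi.symm⟩

/-- On the exceptional divisor over `pᵢ`, the base locus is contained in the common zeros of the
leading forms of the octics. Every tangent direction is represented by a unique line in the
hyperplane `x₀ = 0`, as `pᵢ` does not lie on it. -/
theorem finite_dir_baseLocus (h : GeneralPosition x) (i : Fin 14) :
    {ℓ | ∃ z ∈ baseLocus (fun i => Projectivization.mk K (x i) (hx i)) (4 • quadricClass),
      z.pt = Projectivization.mk K (x i) (hx i) ∧ z.dir i = ℓ}.Finite := by
  obtain ⟨f, hf, h0, hfin⟩ := h.leading_zeros i
  refine (finite_setOf_mem_submodule (K := K)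
    (hfin.image (Projectivization.mk K (x i) (hx i)).submodule.mkQ)).subset ?_
  rintro _ ⟨z, hz, hzp, rfl⟩
  obtain ⟨y, hy, -⟩ := z.exists_isCoord
  obtain ⟨s, hs⟩ := Projectivization.exists_smul_eq_mk_rep K (x i) (hx i)
  set v : Fin 5 → K := y i - (y i 0 * (x i 0)⁻¹) • x i with hv
  have hv0 : v 0 = 0 := by
    simp [hv, h.coord_ne_zero i]
  have hvq : (Projectivization.mk K (x i) (hx i)).submodule.mkQ v =
      (Projectivization.mk K (x i) (hx i)).submodule.mkQ (y i) := by
    rw [hv, map_sub, sub_eq_self, Submodule.mkQ_apply, Submodule.Quotient.mk_eq_zero,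
      Projectivization.submodule_mk]
    exact Submodule.smul_mem _ _ (Submodule.mem_span_singleton_self _)
  have hvdir := (hy.2 i).2
  have hvne := (hy.2 i).1
  rw [← hvq] at hvdir hvne
  have hzero : ∀ w, ∑ β ∈ expo 5 4, hasse 8 (f (some w)) (x i) β * mpow v β = 0 := by
    intro w
    have h1 := (mem_divisorSupport_of_mem_baseLocus hz
      (toForm_octic_mem_globalSections hx hf w)).2 i hzp v hvdir
    change (lineRestriction _ _ _).coeff 4 = 0 at h1
    rw [coeff_lineRestriction_toForm, ← hs, Units.smul_def] at h1
    have h2 : ∑ β ∈ expo 5 4, hasse 8 (f (some w)) ((s : K) • x i) β * mpow v β =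
        (s : K) ^ 4 * ∑ β ∈ expo 5 4, hasse 8 (f (some w)) (x i) β * mpow v β := by
      rw [Finset.mul_sum]
      refine Finset.sum_congr rfl fun β hβ => ?_
      rw [hasse_smul _ _ _ _ hβ, mul_assoc]
    rw [h2] at h1
    exact (mul_eq_zero.mp h1).resolve_left (pow_ne_zero _ s.ne_zero)
  have hv4 : v 4 ≠ 0 := by
    intro h4
    rw [h0 v hv0 h4 hzero, map_zero] at hvne
    exact hvne rfl
  refine ⟨_, ⟨(v 4)⁻¹ • v, ⟨?_, ?_, fun w => ?_⟩, rfl⟩, ?_, ?_⟩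
  · simp [hv0]
  · simp [hv4]
  · rw [sum_smul_mpow (fun β => hasse 8 (f (some w)) (x i) β), hzero, mul_zero]
  · rw [map_smul]
    exact smul_ne_zero (inv_ne_zero hv4) hvne
  · rw [map_smul]
    exact Submodule.smul_mem _ _ hvdir

theorem topologicalKrullDim_baseLocus_le (h : GeneralPosition x) :
    topologicalKrullDim (baseLocus (fun i => Projectivization.mk K (x i) (hx i))
      (4 • quadricClass)) ≤ 0 :=
  topologicalKrullDim_le_zero_of_finite (finite_of_finite_pt_of_finite_dir
    (finite_pt_image_baseLocus hx h) (finite_dir_baseLocus hx h))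

end

end PointBlowUp

theorem proposition6p2 (K : Type*) [Field K] [IsAlgClosed K] [CharZero K] :
    PointBlowUp.ForGeneralPoints K 4 14 fun p =>
      ¬ PointBlowUp.IsSpecial p (4 • PointBlowUp.quadricClass) ∧
      PointBlowUp.dimLinearSystem p (4 • PointBlowUp.quadricClass) = 4 ∧
      topologicalKrullDim (PointBlowUp.baseLocus p (4 • PointBlowUp.quadricClass)) ≤ 0 ∧
      PointBlowUp.IsSpecial p (2 • PointBlowUp.quadricClass) := by
  obtain ⟨Δ, hΔ, hgen⟩ := PointBlowUp.exists_forall_generalPosition K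
  refine ⟨MvPolynomial.map (Int.castRingHom K) Δ, ?_, fun x hx hne => ?_⟩
  · rwa [Ne, map_eq_zero_iff _ (MvPolynomial.map_injective _ (RingHom.injective_int _))]
  · rw [MvPolynomial.eval_map] at hne
    have h := hgen x hne
    refine ⟨?_, PointBlowUp.dimLinearSystem_four_smul hx h,
      PointBlowUp.topologicalKrullDim_baseLocus_le hx h, PointBlowUp.isSpecial_two_smul hx⟩
    rw [PointBlowUp.IsSpecial, PointBlowUp.expectedDim_four_smul,
      PointBlowUp.dimLinearSystem_four_smul hx h]
    exact lt_irrefl _
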